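/- Let $n\in\mathbb N$ and $\vec p=(p_1,\dots,p_n)\in(1,2]^n$. There is a constant $c=c(\vec p)>0$, depending only on $\vec p$ (and thus on $n$), with the following property. Let $\vec\gamma=(\gamma_1,\dots,\gamma_n)\in[0,\infty)^n$, let $\alpha,\beta>0$, and let $u\in C([0,\infty);L^2(\mathbb R^n))$ be the solution, in the sense of tempered distributions, of the free Schrödinger equation $\partial_t u=i\Delta u$, $t>0$, with initial value $u(0)\in L^2(\mathbb R^n)$. Write $$\widehat f(\xi)=(2\pi)^{-n/2}\int_{\mathbb R^n}e^{-ix\cdot\xi}f(x)\,dx,\qquad \theta(t)=\frac{\beta(T-t)}{T(\alpha t+\beta)},\qquad \mu(t)=\frac{\beta}{\alpha t+\beta},$$ where the Fourier transform is extended to $L^2(\mathbb R^n)$ by Plancherel's theorem. Then for every $T>0$ and $0\le t\le T$, $$\Big\|e^{\sum_{j}\gamma_j\left|\frac{x_j}{\alpha t+\beta}\right|^{p_j}}u(t)\Big\|_2\le c\,\Big\|e^{\sum_{j}\gamma_j\left|\frac{x_j}{\beta}\right|^{p_j}}u(0)\Big\|_2^{\theta(t)}\,\Big\|e^{\sum_{j}\gamma_j\left|\frac{x_j}{\alpha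 T+\beta}\right|^{p_j}}u(T)\Big\|_2^{1-\theta(t)},$$ and for every $t\ge 0$, $$\Big\|e^{\sum_{j}\gamma_j\left|\frac{x_j}{\alpha t+\beta}\right|^{p_j}}u(t)\Big\|_2\le c\,\Big\|e^{\sum_{j}\gamma_j\left|\frac{x_j}{\beta}\right|^{p_j}}u(0)\Big\|_2^{\mu(t)}\,\Big\|e^{\sum_{j}\gamma_j\left|\frac{2\xi_j}{\alpha}\right|^{p_j}}\widehat{u(0)}\Big\|_2^{1-\mu(t)}.$$ Here the sums run over $1\le j\le n$, and the norms are taken in $[0,\infty]$ (with $a^0=1$ for all $a\in[0,\infty]$), so that in each inequality the left-hand side is finite whenever the right-hand side is. -/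

import Mathlib

open MeasureTheory FourierTransform
open scoped SchwartzMap Laplacian ENNReal

noncomputable section

/-- The complex Hilbert space `L²(ℝⁿ)` with respect to Lebesgue measure. -/
abbrev L2Space (n : ℕ) : Type := Lp (α := EuclideanSpace ℝ (Fin n)) ℂ 2

/-- `u ∈ C([0,∞); L²(ℝⁿ))` is the solution of the free Schrödinger equation `∂ₜ u = i Δ u`, `t > 0`,
with initial value `u 0`: the equation holds in the sense of tempered distributions, i.e. for every
Schwartz function `φ`, `d/dt ⟨u(t), φ⟩ = i ⟨Δ u(t), φ⟩`, where `⟨f, φ⟩ = ∫ f φ` (no conjugation)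
and `Δ` is the distributional Laplacian. -/
structure IsFreeSchrodingerSolution {n : ℕ} (u : ℝ → L2Space n) : Prop where
  continuousOn : ContinuousOn u (Set.Ici 0)
  hasDerivAt : ∀ t : ℝ, 0 < t → ∀ φ : 𝓢(EuclideanSpace ℝ (Fin n), ℂ),
    HasDerivAt (fun s : ℝ => Lp.toTemperedDistribution (u s) φ)
      (Complex.I * (Δ (Lp.toTemperedDistribution (u t))) φ) t

/-- The Fourier transform on `L²(ℝⁿ)` in the normalisation
`f̂(ξ) = (2π)^(-n/2) ∫ exp(-i x·ξ) f(x) dx` (extended from the Schwartz functions by Plancherel).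
Mathlib's `𝓕 f (η)` is the extension of `∫ exp(-2πi x·η) f(x) dx`. -/
def fourierHat {n : ℕ} (f : L2Space n) (ξ : EuclideanSpace ℝ (Fin n)) : ℂ :=
  (((2 * Real.pi) ^ (-(n : ℝ) / 2) : ℝ) : ℂ) * (𝓕 f : L2Space n) ((2 * Real.pi)⁻¹ • ξ)

/-- The weight `exp (∑ⱼ γⱼ |yⱼ|^{pⱼ})`. -/
def expWeight {n : ℕ} (γ p : Fin n → ℝ) (y : EuclideanSpace ℝ (Fin n)) : ℝ :=
  Real.exp (∑ j, γ j * |y j| ^ p j)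

/-- The weighted norm `‖exp (∑ⱼ γⱼ |s xⱼ|^{pⱼ}) f‖₂`, with values in `[0, ∞]`. -/
def weightedNorm {n : ℕ} (γ p : Fin n → ℝ) (s : ℝ) (f : EuclideanSpace ℝ (Fin n) → ℂ) : ℝ≥0∞ :=
  eLpNorm (fun x => (expWeight γ p (s • x) : ℂ) * f x) 2 volume

/-- The exponent `θ(t) = β (T - t) / (T (α t + β))`. -/
def thetaExp (α β T t : ℝ) : ℝ := β * (T - t) / (T * (α * t + β))

/-- The exponent `μ(t) = β / (α t + β)`. -/
def muExp (α β t : ℝ) : ℝ := β / (α * t + β)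

end

/-! Put s = β/α + t and let v be the free flow of u(0) by time -β/α. Then u(t) = e^{isΔ}v and
x/(αt+β) = (x/s)/α. For a linear weight the flow acts by conjugation: with D = -i∇, e^{-isΔ}
e^{l·x/s} e^{isΔ} = e^{l·(x/s + 2D)}. The norm of e^{l·x/s}u(t) is therefore that of e^{κ l·x + 2
l·D}v with κ = 1/s. Since l·x and l·D commute up to an imaginary scalar, changing κ to κ' only
multiplies by e^{(κ'-κ) l·x} and a phase, so Hölder makes the norm log-convex in κ, with constant 1.
The number 1/s is the average, with weight θ(t), of its values at times 0 and T. The value κ = 0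
leaves e^{2l·D}, a weight on the Fourier side, and averaging with it gives μ(t).

The unbounded operators are handled through pairings with complex Gaussians, on which they act
explicitly and which determine an L² function. The argument is carried by `gaussPair_shift_iff`,
`IsPhaseShift.exists_interpolation` and `expNorm_le_of_isPhaseShiftNorm`.

The weight exp|y|^p is comparable to a superposition of exponentials of tangent lines: in a suitable
parameter the gap between |y|^p and its tangent lies between p-1 and 1 times a square
(`tangent_bounds`, `tangentExp_integral`). The same slopes serve at all times, so a second Hölder
inequality, in the tangent parameter, transfers the estimate (`weightedNorm_le_of_expNorm_le`). Only
this step costs a constant. Finally, `IsFreeSchrodingerSolution.isFreeEvolution` identifies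
distributional solutions with the Fourier multiplier flow. -/

/-! ### Gaussian pairings and the Fourier transform. -/

/-- The complex Gaussian `exp (-a |x|² + b · x)`. -/
noncomputable def gauss {n : ℕ} (a : ℂ) (b : Fin n → ℂ) (x : EuclideanSpace ℝ (Fin n)) : ℂ :=
  Complex.exp (-a * ∑ i, (x i : ℂ) ^ 2 + ∑ i, b i * x i)

/-- The bilinear pairing of `f` with a complex Gaussian. -/
noncomputable def gaussPair {n : ℕ} (f : EuclideanSpace ℝ (Fin n) → ℂ) (a : ℂ) (b : Fin n → ℂ) : ℂ :=
  ∫ x, gauss a b x * f x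

section Gaussian

variable {n : ℕ}

lemma continuous_gauss (a : ℂ) (b : Fin n → ℂ) : Continuous (gauss a b) := by
  unfold gauss; fun_prop

lemma gauss_ne_zero (a : ℂ) (b : Fin n → ℂ) (x : EuclideanSpace ℝ (Fin n)) : gauss a b x ≠ 0 :=
  Complex.exp_ne_zero _

lemma gauss_add (a a' : ℂ) (b b' : Fin n → ℂ) (x : EuclideanSpace ℝ (Fin n)) :
    gauss (a + a') (b + b') x = gauss a b x * gauss a' b' x := by
  simp only [gauss, ← Complex.exp_add, Pi.add_apply, add_mul, Finset.sum_add_distrib]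
  ring_nf

lemma integrable_gauss {a : ℂ} (ha : 0 < a.re) (b : Fin n → ℂ) : Integrable (gauss a b) := by
  rw [← (PiLp.volume_preserving_toLp (Fin n)).integrable_comp_emb
    (MeasurableEquiv.toLp 2 _).measurableEmbedding]
  exact GaussianFourier.integrable_cexp_neg_mul_sum_add ha b

lemma integral_gauss {a : ℂ} (ha : 0 < a.re) (b : Fin n → ℂ) :
    ∫ x, gauss a b x = (Real.pi / a) ^ ((n : ℂ) / 2) * Complex.exp ((∑ i, b i ^ 2) / (4 * a)) := by
  rw [← (PiLp.volume_preserving_toLp (Fin n)).integral_comp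
    (MeasurableEquiv.toLp 2 _).measurableEmbedding]
  simpa [gauss] using GaussianFourier.integral_cexp_neg_mul_sum_add ha b

lemma memLp_gauss {a : ℂ} (ha : 0 < a.re) (b : Fin n → ℂ) : MemLp (gauss a b) 2 := by
  rw [memLp_two_iff_integrable_sq_norm (continuous_gauss a b).aestronglyMeasurable]
  have := (integrable_gauss (a := a + a) (by simpa using ha) (b + b)).norm
  refine this.congr (Filter.Eventually.of_forall fun x => ?_)
  simp only [gauss_add, norm_mul, sq]

lemma fourier_gauss {a : ℂ} (ha : 0 < a.re) (b : Fin n → ℂ) (ξ : EuclideanSpace ℝ (Fin n)) :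
    𝓕 (gauss a b) ξ = (Real.pi / a) ^ ((n : ℂ) / 2) * Complex.exp ((∑ i, b i ^ 2) / (4 * a)) *
      gauss (Real.pi ^ 2 / a) (fun i => -(Real.pi * Complex.I * b i / a)) ξ := by
  have ha0 : a ≠ 0 := by rintro rfl; simp at ha
  rw [Real.fourier_eq']
  have : ∀ v : EuclideanSpace ℝ (Fin n),
      Complex.exp (((-2 * Real.pi * inner ℝ v ξ : ℝ) : ℂ) * Complex.I) • gauss a b v =
      gauss a (fun i => b i - 2 * Real.pi * Complex.I * ξ i) v := by
    intro v
    simp only [gauss, smul_eq_mul, ← Complex.exp_add, PiLp.inner_apply, RCLike.inner_apply,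
      conj_trivial]
    congr 1
    push_cast
    simp only [sub_mul, Finset.sum_sub_distrib, Finset.mul_sum, Finset.sum_mul]
    have : ∀ i, (-2 * (Real.pi : ℂ) * ((ξ i : ℂ) * v i) * Complex.I) =
      - (2 * Real.pi * Complex.I * ξ i * v i) := fun i => by ring
    simp only [this, Finset.sum_neg_distrib]
    ring
  simp_rw [this]
  rw [integral_gauss ha, gauss, mul_assoc ((Real.pi / a : ℂ) ^ ((n : ℂ) / 2)), ← Complex.exp_add]
  congr 2
  have h1 : ∀ i, (b i - 2 * Real.pi * Complex.I * ξ i) ^ 2 =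
      b i ^ 2 + (4 * a) * (-(Real.pi * Complex.I * b i / a) * ξ i)
        - (4 * a) * (Real.pi ^ 2 / a) * (ξ i : ℂ) ^ 2 := fun i => by
    field_simp
    ring_nf
    simp only [Complex.I_sq]
    ring
  simp only [h1, Finset.sum_sub_distrib, Finset.sum_add_distrib, ← Finset.mul_sum]
  field_simp
  ring

lemma continuous_integral_mul {k : EuclideanSpace ℝ (Fin n) → ℂ} (hk : MemLp k 2) :
    Continuous (fun f : L2Space n => ∫ x, k x * f x) := by
  have h2 : MemLp (fun x => (starRingEnd ℂ) (k x)) 2 := hk.star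
  have : (fun f : L2Space n => ∫ x, k x * f x) = fun f => inner ℂ (h2.toLp _) f := by
    ext f
    rw [L2.inner_def]
    refine integral_congr_ae ?_
    filter_upwards [h2.coeFn_toLp] with x hx
    rw [hx]
    simp [mul_comm]
  rw [this]
  exact continuous_const.inner continuous_id

lemma integrable_mul_lp {k : EuclideanSpace ℝ (Fin n) → ℂ} (hk : MemLp k 2) (f : L2Space n) :
    Integrable (fun x => k x * f x) :=
  hk.integrable_mul (Lp.memLp f)

/-- For Schwartz `f` this is Fubini; both sides are L²-continuous in `f`, so density finishes. -/
lemma integral_fourier_mul {k k' : EuclideanSpace ℝ (Fin n) → ℂ} (hk : MemLp k 2)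
    (hk1 : Integrable k) (hk' : 𝓕 k = k') (hk2 : MemLp k' 2) (f : L2Space n) :
    ∫ x, k x * (𝓕 f : L2Space n) x = ∫ x, k' x * f x := by
  refine DenseRange.induction_on
    (p := fun f : L2Space n => ∫ x, k x * (𝓕 f : L2Space n) x = ∫ x, k' x * f x)
    (SchwartzMap.denseRange_toLpCLM (p := 2) ENNReal.ofNat_ne_top) f ?_ ?_
  · exact isClosed_eq ((continuous_integral_mul hk).comp
      (Lp.fourierTransformₗᵢ (EuclideanSpace ℝ (Fin n)) ℂ).continuous) (continuous_integral_mul hk2)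
  · intro g
    simp only [SchwartzMap.toLpCLM_apply, SchwartzMap.toLp_fourier_eq]
    have e1 : ∫ x, k x * ((𝓕 g).toLp 2 : L2Space n) x = ∫ x, k x * 𝓕 (g : _ → ℂ) x := by
      refine integral_congr_ae ?_
      filter_upwards [(𝓕 g).coeFn_toLp 2] with x hx
      rw [hx, SchwartzMap.fourier_coe]
    have e2 : ∫ x, k' x * (g.toLp 2 : L2Space n) x = ∫ x, 𝓕 k x * g x := by
      refine integral_congr_ae ?_
      filter_upwards [g.coeFn_toLp 2] with x hx
      rw [hx, hk']
    rw [e1, e2]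
    simpa using! (VectorFourier.integral_fourierIntegral_smul_eq_flip
      (L := innerₗ (EuclideanSpace ℝ (Fin n))) Real.continuous_fourierChar
      continuous_inner hk1 g.integrable).symm

lemma gaussPair_fourier (f : L2Space n) {a : ℂ} (ha : 0 < a.re) (b : Fin n → ℂ) :
    gaussPair (𝓕 f : L2Space n) a b =
      (Real.pi / a) ^ ((n : ℂ) / 2) * Complex.exp ((∑ i, b i ^ 2) / (4 * a)) *
      gaussPair f (Real.pi ^ 2 / a) (fun i => -(Real.pi * Complex.I * b i / a)) := by
  have ha' : 0 < (Real.pi ^ 2 / a : ℂ).re := by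
    have ha0 : a ≠ 0 := by rintro rfl; simp at ha
    have : (Real.pi ^ 2 / a : ℂ) = ((Real.pi ^ 2 : ℝ) : ℂ) * a⁻¹ := by push_cast; rfl
    rw [this, Complex.re_ofReal_mul, Complex.inv_re]
    have := Complex.normSq_pos.2 ha0
    positivity
  have h := integral_fourier_mul (memLp_gauss ha b) (integrable_gauss ha b)
    (funext (fourier_gauss ha b)) ((memLp_gauss ha' _).const_mul _) f
  rw [gaussPair, gaussPair, h, ← integral_const_mul]
  simp only [mul_assoc]

/-- Every test function is the Fourier transform of a Schwartz function, and the transform can be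
moved across the integral onto `r`. -/
lemma ae_eq_zero_of_fourier_eq_zero {r : EuclideanSpace ℝ (Fin n) → ℂ} (hr : Integrable r)
    (h : ∀ ξ, 𝓕 r ξ = 0) : r =ᵐ[volume] 0 := by
  refine ae_eq_zero_of_integral_contDiff_smul_eq_zero hr.locallyIntegrable fun g hg hc => ?_
  have hg₁ : HasCompactSupport (Complex.ofRealCLM ∘ g) := hc.comp_left rfl
  have hg₂ : ContDiff ℝ (⊤ : ℕ∞) (Complex.ofRealCLM ∘ g) := by fun_prop
  set φ := 𝓕⁻ (hg₁.toSchwartzMap hg₂) with hφ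
  have hφ' : 𝓕 (φ : EuclideanSpace ℝ (Fin n) → ℂ) = fun x => (g x : ℂ) := by
    rw [← SchwartzMap.fourier_coe, hφ, FourierTransform.fourier_fourierInv_eq]
    rfl
  have := VectorFourier.integral_fourierIntegral_smul_eq_flip
      (L := innerₗ (EuclideanSpace ℝ (Fin n))) Real.continuous_fourierChar
      continuous_inner (φ.integrable (μ := volume)) hr
  have h2 : ∫ x, 𝓕 (φ : EuclideanSpace ℝ (Fin n) → ℂ) x • r x = ∫ x, φ x • 𝓕 r x := by
    simpa using! this
  rw [hφ'] at h2
  simpa [h] using h2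

end Gaussian

/-! ### The free flow as a Fourier multiplier, and its action on Gaussian pairings. -/

/-- `g` is the value at time `s` of the free Schrödinger flow started at `f`, expressed through the
Fourier multiplier `exp (-4π² i s |ξ|²)`. -/
def IsFreeEvolution {n : ℕ} (s : ℝ) (f g : L2Space n) : Prop :=
  (𝓕 g : L2Space n) =ᵐ[volume]
    fun ξ => gauss (4 * Real.pi ^ 2 * s * Complex.I) 0 ξ * (𝓕 f : L2Space n) ξ

section Evolution

variable {n : ℕ}

lemma norm_gauss_I (s : ℝ) (ξ : EuclideanSpace ℝ (Fin n)) :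
    ‖gauss (4 * Real.pi ^ 2 * s * Complex.I) 0 ξ‖ = 1 := by
  have : (-(4 * Real.pi ^ 2 * s * Complex.I) * ∑ i, (ξ i : ℂ) ^ 2 : ℂ) =
      ((-(4 * Real.pi ^ 2 * s) * ∑ i, ξ i ^ 2 : ℝ) : ℂ) * Complex.I := by
    push_cast; ring
  simp only [gauss, Pi.zero_apply, zero_mul, Finset.sum_const_zero, add_zero]
  rw [this, Complex.norm_exp_ofReal_mul_I]

lemma exists_isFreeEvolution (s : ℝ) (f : L2Space n) : ∃ g, IsFreeEvolution s f g := by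
  have hm : MemLp (fun ξ => gauss (4 * Real.pi ^ 2 * s * Complex.I) 0 ξ * (𝓕 f : L2Space n) ξ)
      2 volume := by
    refine (memLp_congr_norm ((continuous_gauss _ _).aestronglyMeasurable.mul
      (Lp.aestronglyMeasurable _)) (Lp.aestronglyMeasurable (𝓕 f : L2Space n)) ?_).2
      (Lp.memLp (𝓕 f : L2Space n))
    exact Filter.Eventually.of_forall fun ξ => by
      rw [Pi.mul_apply, norm_mul, norm_gauss_I, one_mul]
  refine ⟨𝓕⁻ (hm.toLp _), ?_⟩
  rw [IsFreeEvolution, FourierTransform.fourier_fourierInv_eq]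
  exact hm.coeFn_toLp

lemma IsFreeEvolution.symm {s : ℝ} {f g : L2Space n} (h : IsFreeEvolution s f g) :
    IsFreeEvolution (-s) g f := by
  filter_upwards [h] with ξ hξ
  rw [hξ, ← mul_assoc, ← gauss_add]
  simp [gauss]

lemma IsFreeEvolution.trans {s t : ℝ} {f g k : L2Space n} (h : IsFreeEvolution s f g)
    (h' : IsFreeEvolution t g k) : IsFreeEvolution (s + t) f k := by
  filter_upwards [h, h'] with ξ hξ hξ'
  rw [hξ', hξ, ← mul_assoc, ← gauss_add]
  congr 2
  · push_cast; ring
  · simp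

lemma IsFreeEvolution.norm_eq {s : ℝ} {f g : L2Space n} (h : IsFreeEvolution s f g) :
    ‖g‖ = ‖f‖ := by
  rw [← Lp.norm_fourier_eq g, ← Lp.norm_fourier_eq f, Lp.norm_def, Lp.norm_def]
  congr 1
  refine eLpNorm_congr_norm_ae ?_
  filter_upwards [h] with ξ hξ
  rw [hξ, norm_mul, norm_gauss_I, one_mul]

lemma gaussPair_congr {f g : EuclideanSpace ℝ (Fin n) → ℂ} (h : f =ᵐ[volume] g) (a : ℂ)
    (b : Fin n → ℂ) : gaussPair f a b = gaussPair g a b :=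
  integral_congr_ae (h.mono fun x hx => by simp only [hx])

lemma gaussPair_gauss_mul (f : EuclideanSpace ℝ (Fin n) → ℂ) (a a' : ℂ) (b b' : Fin n → ℂ) :
    gaussPair (fun x => gauss a' b' x * f x) a b = gaussPair f (a + a') (b + b') := by
  simp only [gaussPair, gauss_add, mul_assoc]

lemma re_div_pos_of_re_pos {r : ℝ} (hr : 0 < r) {a : ℂ} (ha : 0 < a.re) : 0 < ((r : ℂ) / a).re := by
  have ha0 : a ≠ 0 := by rintro rfl; simp at ha
  rw [div_eq_mul_inv, Complex.re_ofReal_mul, Complex.inv_re]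
  have := Complex.normSq_pos.2 ha0
  positivity

/-- The constant is uniform in `f` and `b`, so it cancels later and the branch of the complex power
never matters. -/
lemma gaussPair_eq_fourier {a : ℂ} (ha : 0 < a.re) : ∃ C : ℂ, C ≠ 0 ∧
    ∀ (f : L2Space n) (b : Fin n → ℂ),
      gaussPair (𝓕 f : L2Space n) (Real.pi ^ 2 / a) (fun i => Real.pi * Complex.I * b i / a) =
        C * Complex.exp (-(∑ i, b i ^ 2) / (4 * a)) * gaussPair f a b := by
  have ha0 : a ≠ 0 := by rintro rfl; simp at ha
  have hpi : (Real.pi : ℂ) ≠ 0 := Complex.ofReal_ne_zero.2 Real.pi_ne_zero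
  have ha' : 0 < (Real.pi ^ 2 / a : ℂ).re := by
    have := re_div_pos_of_re_pos (r := Real.pi ^ 2) (by positivity) ha
    rwa [Complex.ofReal_pow] at this
  refine ⟨(Real.pi / (Real.pi ^ 2 / a)) ^ ((n : ℂ) / 2), ?_, fun f b => ?_⟩
  · rw [Complex.cpow_ne_zero_iff]
    left
    positivity
  · rw [gaussPair_fourier f ha']
    have e1 : (Real.pi ^ 2 / (Real.pi ^ 2 / a) : ℂ) = a := by field_simp
    have e2 : (fun i => -(Real.pi * Complex.I * (Real.pi * Complex.I * b i / a) /
        (Real.pi ^ 2 / a))) = b := by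
      ext i
      field_simp
      simp
    rw [e1, e2]
    congr 3
    have e3 : ∀ i, (Real.pi * Complex.I * b i / a) ^ 2 = -(Real.pi ^ 2 / a ^ 2) * b i ^ 2 := by
      intro i
      field_simp
      simp
    simp only [e3, ← Finset.mul_sum]
    field_simp

/-- The action of the free flow on Gaussian pairings. -/
lemma gaussPair_evolution {a : ℂ} (ha : 0 < a.re) {s : ℝ} {E : ℂ}
    (hE : E = 1 - 4 * Complex.I * a * s) : E ≠ 0 ∧ 0 < (a / E).re ∧ ∃ C : ℂ, C ≠ 0 ∧
    ∀ f g : L2Space n, IsFreeEvolution s f g → ∀ b : Fin n → ℂ,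
      gaussPair g (a / E) (fun i => b i / E) =
        C * Complex.exp (Complex.I * s * (∑ i, b i ^ 2) / E) * gaussPair f a b := by
  have ha0 : a ≠ 0 := by rintro rfl; simp at ha
  have hE' : E / a = ((1 : ℝ) : ℂ) / a - 4 * Complex.I * s := by
    rw [hE]; push_cast; field_simp
  have hpos : 0 < (E / a).re := by
    rw [hE']
    have := re_div_pos_of_re_pos one_pos ha
    simpa using this
  have hE0 : E ≠ 0 := by rintro rfl; simp at hpos
  have hpos' : 0 < (a / E).re := by
    have := re_div_pos_of_re_pos one_pos hpos
    rwa [Complex.ofReal_one, one_div_div] at this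
  refine ⟨hE0, hpos', ?_⟩
  obtain ⟨C1, hC1, h1⟩ := gaussPair_eq_fourier (n := n) ha
  obtain ⟨C2, hC2, h2⟩ := gaussPair_eq_fourier (n := n) hpos'
  refine ⟨C1 / C2, div_ne_zero hC1 hC2, fun f g hfg b => ?_⟩
  have k1 := h1 f b
  have k2 := h2 g (fun i => b i / E)
  rw [gaussPair_congr hfg, gaussPair_gauss_mul, add_zero] at k2
  -- The multiplier translates the reciprocal width; `E` is chosen so that both pairings become the
  -- same pairing with `𝓕 f`.
  have e1 : (Real.pi ^ 2 / (a / E) + 4 * Real.pi ^ 2 * s * Complex.I : ℂ) = Real.pi ^ 2 / a := by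
    rw [div_div_eq_mul_div, mul_div_assoc, hE']
    push_cast
    ring
  have e2 : (fun i => Real.pi * Complex.I * (b i / E) / (a / E)) =
      fun i => Real.pi * Complex.I * b i / a := by
    ext i; field_simp
  rw [e1, e2, k1] at k2
  have e3 : Complex.exp (-(∑ i, b i ^ 2) / (4 * a)) =
      Complex.exp (-(∑ i, (b i / E) ^ 2) / (4 * (a / E))) *
      Complex.exp (Complex.I * s * (∑ i, b i ^ 2) / E) := by
    rw [← Complex.exp_add]
    congr 1
    simp only [div_pow, ← Finset.sum_div]
    field_simp
    rw [hE]
    ring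
  rw [e3] at k2
  have hexp := Complex.exp_ne_zero (-(∑ i, (b i / E) ^ 2) / (4 * (a / E)))
  refine mul_left_cancel₀ (mul_ne_zero hC2 hexp) ?_
  rw [← k2]
  field_simp

lemma integrable_gauss_mul {a : ℂ} (ha : 0 < a.re) (b : Fin n → ℂ) (f : L2Space n) :
    Integrable (fun x => gauss a b x * f x) :=
  integrable_mul_lp (memLp_gauss ha b) f

/-- Gaussian pairings with one fixed width determine a function. -/
lemma ae_eq_of_gaussPair_eq {a : ℂ} (ha : 0 < a.re) (f g : L2Space n) (c : ℂ) (d : Fin n → ℂ)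
    (h : ∀ b, gaussPair f a b = c * gaussPair g a (b + d)) :
    f =ᵐ[volume] fun x => c * (gauss 0 d x * g x) := by
  have hr1 := integrable_gauss_mul ha 0 f
  have hr2 := (integrable_gauss_mul ha d g).const_mul c
  have hz := ae_eq_zero_of_fourier_eq_zero (hr1.sub hr2) ?_
  · filter_upwards [hz] with x hx
    simp only [Pi.sub_apply, Pi.zero_apply, sub_eq_zero] at hx
    have e : gauss a d x = gauss a 0 x * gauss 0 d x := by rw [← gauss_add]; simp
    refine mul_left_cancel₀ (gauss_ne_zero a 0 x) ?_
    rw [hx, e]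
    ring
  · intro ξ
    -- Imaginary `b` suffice: they give the Fourier transform of the integrable difference after
    -- multiplication by a Gaussian.
    set b : Fin n → ℂ := fun i => -2 * Real.pi * Complex.I * ξ i with hb
    have hk := h b
    rw [Real.fourier_eq', ← sub_eq_zero.2 hk, gaussPair, gaussPair, ← integral_const_mul,
      ← integral_sub (integrable_gauss_mul ha _ f) ((integrable_gauss_mul ha _ g).const_mul c)]
    congr with x
    have e : Complex.exp (((-2 * Real.pi * inner ℝ x ξ : ℝ) : ℂ) * Complex.I) = gauss 0 b x := by
      simp only [gauss, PiLp.inner_apply, RCLike.inner_apply, conj_trivial, hb]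
      push_cast
      simp only [Finset.mul_sum, Finset.sum_mul, neg_zero, zero_mul,
        Finset.sum_const_zero, zero_add]
      congr 1
      refine Finset.sum_congr rfl fun i _ => by ring
    rw [e]
    have e1 : gauss a b x = gauss 0 b x * gauss a 0 x := by rw [← gauss_add]; simp
    have e2 : gauss a (b + d) x = gauss 0 b x * gauss a d x := by rw [← gauss_add]; simp
    rw [e1, e2, smul_eq_mul, Pi.sub_apply]
    ring

end Evolution

/-! ### Linear exponential weights and phase space shifts. -/

/-- The norm `‖exp (l · x) f‖₂` in `[0, ∞]`. -/
noncomputable def expNorm {n : ℕ} (l : Fin n → ℝ) (f : EuclideanSpace ℝ (Fin n) → ℂ) : ℝ≥0∞ :=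
  eLpNorm (fun x => gauss 0 (fun i => (l i : ℂ)) x * f x) 2 volume

/-- In terms of Gaussian pairings, `g = c exp (κ l · x - 2 l · D) v` with `D = -i ∇` and a
unimodular constant `c`. -/
def IsPhaseShift {n : ℕ} (v : L2Space n) (l : Fin n → ℝ) (κ : ℝ) (g : L2Space n) : Prop :=
  ∃ c : ℂ, ‖c‖ = 1 ∧ ∀ a : ℂ, 0 < a.re → ∀ b : Fin n → ℂ,
    gaussPair g a b = c * Complex.exp (4 * a * ∑ i, (l i : ℂ) ^ 2 + 2 * Complex.I * ∑ i, b i * l i) *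
      gaussPair v a (fun i => b i + κ * l i - 4 * Complex.I * a * l i)

/-- `N` is the norm in `[0, ∞]` of the phase space shift of `v` with parameter `κ`. -/
def IsPhaseShiftNorm {n : ℕ} (v : L2Space n) (l : Fin n → ℝ) (κ : ℝ) (N : ℝ≥0∞) : Prop :=
  (N ≠ ∞ → ∃ g, IsPhaseShift v l κ g ∧ eLpNorm g 2 volume = N) ∧ (N = 0 → v = 0)

section LinearWeights

variable {n : ℕ}

lemma eLpNorm_two_le_of_enorm_le {α : Type*} [MeasurableSpace α] {μ : Measure α}
    {f f₀ f₁ : α → ℂ} (h₀ : AEStronglyMeasurable f₀ μ) (h₁ : AEStronglyMeasurable f₁ μ) {θ : ℝ}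
    (hθ : 0 ≤ θ) (hθ' : θ ≤ 1)
    (h : ∀ᵐ x ∂μ, ‖f x‖ₑ ≤ ‖f₀ x‖ₑ ^ θ * ‖f₁ x‖ₑ ^ (1 - θ)) :
    eLpNorm f 2 μ ≤ eLpNorm f₀ 2 μ ^ θ * eLpNorm f₁ 2 μ ^ (1 - θ) := by
  have e : ∀ F : α → ℂ, eLpNorm F 2 μ = (∫⁻ x, ‖F x‖ₑ ^ (2 : ℝ) ∂μ) ^ (1 / 2 : ℝ) := fun F => by
    rw [eLpNorm_eq_lintegral_rpow_enorm_toReal two_ne_zero ENNReal.ofNat_ne_top]; simp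
  have hθ1 : 0 ≤ 1 - θ := by linarith
  rw [e, e, e, ← ENNReal.rpow_mul, ← ENNReal.rpow_mul, mul_comm (1 / 2 : ℝ), mul_comm (1 / 2 : ℝ),
    ENNReal.rpow_mul, ENNReal.rpow_mul, ← ENNReal.mul_rpow_of_nonneg _ _ (by norm_num)]
  refine ENNReal.rpow_le_rpow ?_ (by norm_num)
  refine le_trans (lintegral_mono_ae ?_) (ENNReal.lintegral_mul_norm_pow_le
    (h₀.enorm.pow_const (2 : ℝ)) (h₁.enorm.pow_const (2 : ℝ)) hθ hθ1 (by ring))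
  filter_upwards [h] with x hx
  refine (ENNReal.rpow_le_rpow hx (by norm_num)).trans_eq ?_
  rw [ENNReal.mul_rpow_of_nonneg _ _ (by norm_num), ← ENNReal.rpow_mul, ← ENNReal.rpow_mul,
    ← ENNReal.rpow_mul, ← ENNReal.rpow_mul, mul_comm θ, mul_comm (1 - θ)]

lemma norm_gauss_zero (l : Fin n → ℝ) (x : EuclideanSpace ℝ (Fin n)) :
    ‖gauss 0 (fun i => (l i : ℂ)) x‖ = Real.exp (∑ i, l i * x i) := by
  have : (∑ i, (l i : ℂ) * (x i : ℂ)) = ((∑ i, l i * x i : ℝ) : ℂ) := by push_cast; rfl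
  simp only [gauss, neg_zero, zero_mul, zero_add]
  rw [this, Complex.norm_exp_ofReal]

lemma norm_cexp_I_mul (r : ℝ) : ‖Complex.exp (Complex.I * r)‖ = 1 := by
  rw [mul_comm, Complex.norm_exp_ofReal_mul_I]

/-- Two phase space shifts differ by a real exponential factor. -/
lemma IsPhaseShift.ae_eq {v : L2Space n} {l : Fin n → ℝ} {κ₀ κ₁ : ℝ} {g₀ g₁ : L2Space n}
    (h₀ : IsPhaseShift v l κ₀ g₀) (h₁ : IsPhaseShift v l κ₁ g₁) :
    ∃ c : ℂ, ‖c‖ = 1 ∧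
      g₀ =ᵐ[volume] fun x => c * (gauss 0 (fun i => (((κ₀ - κ₁) * l i : ℝ) : ℂ)) x * g₁ x) := by
  obtain ⟨c₀, hc₀, h₀⟩ := h₀
  obtain ⟨c₁, hc₁, h₁⟩ := h₁
  have hc₁' : c₁ ≠ 0 := by rintro rfl; simp at hc₁
  -- The phase is the Baker–Campbell–Hausdorff factor from the commutator of l·x and l·D. Any fixed
  -- width determines the functions; `a = 1` is convenient.
  refine ⟨c₀ / c₁ * Complex.exp (Complex.I * ((-2 * (κ₀ - κ₁) * ∑ i, l i ^ 2 : ℝ) : ℂ)), ?_,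
    ae_eq_of_gaussPair_eq (a := 1) (by simp) _ _ _ _ fun b => ?_⟩
  · rw [norm_mul, norm_cexp_I_mul, norm_div, hc₀, hc₁]; norm_num
  · rw [h₀ 1 (by simp), h₁ 1 (by simp)]
    have e1 : (fun i => (b + fun i => (((κ₀ - κ₁) * l i : ℝ) : ℂ)) i + κ₁ * l i -
        4 * Complex.I * 1 * l i) = fun i => b i + κ₀ * l i - 4 * Complex.I * 1 * l i := by
      ext i; simp only [Pi.add_apply]; push_cast; ring
    rw [e1]
    have e2 : Complex.exp (4 * 1 * ∑ i, (l i : ℂ) ^ 2 + 2 * Complex.I * ∑ i, b i * l i) =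
        Complex.exp (Complex.I * ((-2 * (κ₀ - κ₁) * ∑ i, l i ^ 2 : ℝ) : ℂ)) *
        Complex.exp (4 * 1 * ∑ i, (l i : ℂ) ^ 2 +
          2 * Complex.I * ∑ i, (b + fun i => (((κ₀ - κ₁) * l i : ℝ) : ℂ)) i * l i) := by
      rw [← Complex.exp_add]
      congr 1
      have : ∀ i, (b + fun i => (((κ₀ - κ₁) * l i : ℝ) : ℂ)) i * l i =
          b i * l i + (κ₀ - κ₁) * (l i : ℂ) ^ 2 := fun i => by
        simp only [Pi.add_apply]; push_cast; ring
      simp only [this, Finset.sum_add_distrib, ← Finset.mul_sum]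
      push_cast
      ring
    rw [e2]
    field_simp

lemma IsPhaseShift.of_ae_eq {v : L2Space n} {l : Fin n → ℝ} {κ κ₁ : ℝ} {h g₁ : L2Space n}
    (h₁ : IsPhaseShift v l κ₁ g₁)
    (hh : h =ᵐ[volume] fun x => gauss 0 (fun i => (((κ - κ₁) * l i : ℝ) : ℂ)) x * g₁ x) :
    IsPhaseShift v l κ h := by
  obtain ⟨c₁, hc₁, h₁⟩ := h₁
  refine ⟨c₁ * Complex.exp (Complex.I * ((2 * (κ - κ₁) * ∑ i, l i ^ 2 : ℝ) : ℂ)), ?_,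
    fun a ha b => ?_⟩
  · rw [norm_mul, norm_cexp_I_mul, hc₁, one_mul]
  · rw [gaussPair_congr hh, gaussPair_gauss_mul, add_zero, h₁ a ha]
    have e1 : (fun i => (b + fun i => (((κ - κ₁) * l i : ℝ) : ℂ)) i + κ₁ * l i -
        4 * Complex.I * a * l i) = fun i => b i + κ * l i - 4 * Complex.I * a * l i := by
      ext i; simp only [Pi.add_apply]; push_cast; ring
    rw [e1]
    congr 1
    rw [mul_assoc c₁, ← Complex.exp_add]
    congr 2
    have : ∀ i, (b + fun i => (((κ - κ₁) * l i : ℝ) : ℂ)) i * l i =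
        b i * l i + (κ - κ₁) * (l i : ℂ) ^ 2 := fun i => by
      simp only [Pi.add_apply]; push_cast; ring
    simp only [this, Finset.sum_add_distrib, ← Finset.mul_sum]
    push_cast
    ring

/-- Logarithmic convexity of the norm of the phase space shifts. -/
lemma IsPhaseShift.exists_interpolation {v : L2Space n} {l : Fin n → ℝ} {κ₀ κ₁ κ θ : ℝ}
    {g₀ g₁ : L2Space n} (h₀ : IsPhaseShift v l κ₀ g₀) (h₁ : IsPhaseShift v l κ₁ g₁)
    (hθ : 0 ≤ θ) (hθ' : θ ≤ 1) (hκ : κ = θ * κ₀ + (1 - θ) * κ₁) :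
    ∃ h, IsPhaseShift v l κ h ∧
      eLpNorm h 2 volume ≤ eLpNorm g₀ 2 volume ^ θ * eLpNorm g₁ 2 volume ^ (1 - θ) := by
  obtain ⟨c, hc, hae⟩ := h₀.ae_eq h₁
  set F : EuclideanSpace ℝ (Fin n) → ℂ :=
    fun x => gauss 0 (fun i => (((κ - κ₁) * l i : ℝ) : ℂ)) x * g₁ x with hF
  have hle : eLpNorm F 2 volume ≤
      eLpNorm g₀ 2 volume ^ θ * eLpNorm g₁ 2 volume ^ (1 - θ) := by
    refine eLpNorm_two_le_of_enorm_le (Lp.aestronglyMeasurable g₀) (Lp.aestronglyMeasurable g₁)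
      hθ hθ' ?_
    -- Equality holds pointwise: up to a phase, g₀ is a real exponential times g₁, and the exponent
    -- is linear in κ.
    filter_upwards [hae] with x hx
    have hθ1 : 0 ≤ 1 - θ := by linarith
    rw [← ofReal_norm, ← ofReal_norm, ← ofReal_norm,
      ENNReal.ofReal_rpow_of_nonneg (norm_nonneg _) hθ,
      ENNReal.ofReal_rpow_of_nonneg (norm_nonneg _) hθ1,
      ← ENNReal.ofReal_mul (by positivity)]
    refine ENNReal.ofReal_le_ofReal (le_of_eq ?_)
    rw [hx, hF, norm_mul, norm_mul, norm_mul, hc, one_mul, norm_gauss_zero, norm_gauss_zero,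
      Real.mul_rpow (Real.exp_pos _).le (norm_nonneg _), mul_assoc,
      ← Real.rpow_add_of_nonneg (norm_nonneg _) hθ hθ1, add_sub_cancel, Real.rpow_one,
      ← Real.exp_mul, Finset.sum_mul, hκ]
    congr 2
    refine Finset.sum_congr rfl fun i _ => by ring
  have hm : MemLp F 2 volume := by
    refine ⟨(continuous_gauss _ _).aestronglyMeasurable.mul (Lp.aestronglyMeasurable g₁),
      hle.trans_lt ?_⟩
    have hθ1 : 0 ≤ 1 - θ := by linarith
    exact ENNReal.mul_lt_top (ENNReal.rpow_lt_top_of_nonneg hθ (Lp.eLpNorm_ne_top g₀))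
      (ENNReal.rpow_lt_top_of_nonneg hθ1 (Lp.eLpNorm_ne_top g₁))
  refine ⟨hm.toLp F, h₁.of_ae_eq hm.coeFn_toLp, ?_⟩
  rwa [eLpNorm_congr_ae hm.coeFn_toLp]

/-- How the free flow intertwines real exponential weights and phase space shifts. -/
lemma gaussPair_shift_iff {s κ : ℝ} (hs : κ * s = 1) {v u h G : L2Space n}
    (hu : IsFreeEvolution s v u) (hG : IsFreeEvolution s h G) (l : Fin n → ℝ) {a : ℂ}
    (ha : 0 < a.re) {E : ℂ} (hE : E = 1 - 4 * Complex.I * a * s) (c : ℂ) (b : Fin n → ℂ) :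
    gaussPair h a b =
        c * Complex.exp (4 * a * ∑ i, (l i : ℂ) ^ 2 + 2 * Complex.I * ∑ i, b i * l i) *
          gaussPair v a (fun i => b i + κ * l i - 4 * Complex.I * a * l i) ↔
      gaussPair G (a / E) (fun i => b i / E) =
        c * Complex.exp (Complex.I * ((-κ * ∑ i, l i ^ 2 : ℝ) : ℂ)) *
          gaussPair u (a / E) ((fun i => b i / E) + fun i => ((κ * l i : ℝ) : ℂ)) := by
  obtain ⟨hE0, -, C, hC, hev⟩ := gaussPair_evolution (n := n) ha hE
  have hsC : (κ : ℂ) * s = 1 := by exact_mod_cast hs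
  have e1 : ((fun i => b i / E) + fun i => ((κ * l i : ℝ) : ℂ)) =
      fun i => (b i + κ * l i - 4 * Complex.I * a * l i) / E := by
    ext i
    simp only [Pi.add_apply]
    field_simp
    rw [hE]
    push_cast
    linear_combination (-4 * Complex.I * a * l i) * hsC
  have e2 : Complex.exp (Complex.I * s *
      (∑ i, (b i + κ * l i - 4 * Complex.I * a * l i) ^ 2) / E) =
      Complex.exp (Complex.I * s * (∑ i, b i ^ 2) / E) *
      (Complex.exp (4 * a * ∑ i, (l i : ℂ) ^ 2 + 2 * Complex.I * ∑ i, b i * l i) *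
        Complex.exp (-(Complex.I * ((-κ * ∑ i, l i ^ 2 : ℝ) : ℂ)))) := by
    rw [← Complex.exp_add, ← Complex.exp_add]
    congr 1
    -- This is where `κ * s = 1` enters: the shift of `b` by (κ - 4ia)l becomes, after division by
    -- `E`, the real shift κl.
    have hκE : κ * E = κ - 4 * Complex.I * a := by
      rw [hE]; linear_combination (-4 * Complex.I * a) * hsC
    have hsq : ∀ i, (b i + κ * l i - 4 * Complex.I * a * l i) ^ 2 =
        b i ^ 2 + (2 * (κ * E)) * (b i * l i) + (κ * E) ^ 2 * (l i : ℂ) ^ 2 := fun i => by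
      rw [hκE]; ring
    simp only [hsq, Finset.sum_add_distrib, ← Finset.mul_sum]
    have : Complex.I * s * (∑ i, b i ^ 2 + 2 * (κ * E) * ∑ i, b i * l i +
        (κ * E) ^ 2 * ∑ i, (l i : ℂ) ^ 2) / E = Complex.I * s * (∑ i, b i ^ 2) / E +
        2 * Complex.I * (κ * s) * ∑ i, b i * l i +
        Complex.I * (κ * s) * (κ * E) * ∑ i, (l i : ℂ) ^ 2 := by
      field_simp
    rw [this, hsC, hκE]
    push_cast
    linear_combination (-4 * a * ∑ i, (l i : ℂ) ^ 2) * Complex.I_sq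
  rw [hev h G hG b, e1, hev v u hu, e2, Complex.exp_neg]
  have := Complex.exp_ne_zero (Complex.I * s * (∑ i, b i ^ 2) / E)
  have := Complex.exp_ne_zero (Complex.I * ((-κ * ∑ i, l i ^ 2 : ℝ) : ℂ))
  constructor
  · intro h
    rw [h]
    field_simp
  · intro h
    refine mul_left_cancel₀ (mul_ne_zero hC ‹Complex.exp (Complex.I * s * (∑ i, b i ^ 2) / E) ≠ 0›) ?_
    rw [h]
    field_simp

end LinearWeights

/-! ### Logarithmic convexity for linear weights. -/

section LogConvexity

variable {n : ℕ}

lemma IsFreeEvolution.eLpNorm_eq {s : ℝ} {f g : L2Space n} (h : IsFreeEvolution s f g) :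
    eLpNorm g 2 volume = eLpNorm f 2 volume := by
  have := h.norm_eq
  rw [Lp.norm_def, Lp.norm_def] at this
  exact (ENNReal.toReal_eq_toReal_iff' (Lp.eLpNorm_ne_top g) (Lp.eLpNorm_ne_top f)).1 this

lemma IsFreeEvolution.eq_zero {s : ℝ} {f g : L2Space n} (h : IsFreeEvolution s f g)
    (hg : g = 0) : f = 0 := by
  have := h.norm_eq
  rwa [hg, norm_zero, eq_comm, norm_eq_zero] at this

lemma aestronglyMeasurable_gauss_mul (b : Fin n → ℂ) (f : L2Space n) :
    AEStronglyMeasurable (fun x => gauss 0 b x * f x) volume :=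
  (continuous_gauss _ _).aestronglyMeasurable.mul (Lp.aestronglyMeasurable f)

lemma eq_zero_of_expNorm_eq_zero {l : Fin n → ℝ} {f : L2Space n} (h : expNorm l f = 0) : f = 0 := by
  rw [expNorm, eLpNorm_eq_zero_iff (aestronglyMeasurable_gauss_mul _ f) two_ne_zero] at h
  rw [Lp.eq_zero_iff_ae_eq_zero]
  filter_upwards [h] with x hx
  exact (mul_eq_zero.1 hx).resolve_left (gauss_ne_zero _ _ _)

/-- When the weighted function is in L², flowing it back by time `s` produces the phase space shift
of `v` without changing the norm. -/
lemma isPhaseShiftNorm_expNorm {s : ℝ} (hs : s ≠ 0) {v u : L2Space n} (hu : IsFreeEvolution s v u)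
    (l : Fin n → ℝ) : IsPhaseShiftNorm v l s⁻¹ (expNorm (fun i => s⁻¹ * l i) u) := by
  refine ⟨fun hN => ?_, fun hN => hu.eq_zero (eq_zero_of_expNorm_eq_zero hN)⟩
  have hm : MemLp (fun x => gauss 0 (fun i => ((s⁻¹ * l i : ℝ) : ℂ)) x * u x) 2 volume :=
    ⟨aestronglyMeasurable_gauss_mul _ u, hN.lt_top⟩
  obtain ⟨h, hh⟩ := exists_isFreeEvolution (-s) (hm.toLp _)
  have hG := hh.symm
  rw [neg_neg] at hG
  refine ⟨h, ⟨Complex.exp (Complex.I * ((s⁻¹ * ∑ i, l i ^ 2 : ℝ) : ℂ)), norm_cexp_I_mul _,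
    fun a ha b => ?_⟩, ?_⟩
  · have := gaussPair_shift_iff (inv_mul_cancel₀ hs) hu hG l ha rfl
      (Complex.exp (Complex.I * ((s⁻¹ * ∑ i, l i ^ 2 : ℝ) : ℂ))) b
    rw [this, gaussPair_congr hm.coeFn_toLp, gaussPair_gauss_mul, add_zero, ← Complex.exp_add]
    push_cast
    rw [neg_mul, mul_neg, add_neg_cancel, Complex.exp_zero, one_mul]
  · rw [hh.eLpNorm_eq, eLpNorm_congr_ae hm.coeFn_toLp, expNorm]

/-- The converse passage: flowing a shift forward gives the weighted `u` up to a phase, so the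
weighted norm is automatically finite. -/
lemma IsPhaseShift.expNorm_eq {s : ℝ} (hs : s ≠ 0) {v u h : L2Space n} {l : Fin n → ℝ}
    (hh : IsPhaseShift v l s⁻¹ h) (hu : IsFreeEvolution s v u) :
    expNorm (fun i => s⁻¹ * l i) u = eLpNorm h 2 volume := by
  obtain ⟨G, hG⟩ := exists_isFreeEvolution s h
  obtain ⟨c, hc, hsh⟩ := hh
  have ha : 0 < ((1 : ℂ) / (1 + 4 * Complex.I * s)).re := by
    rw [one_div, Complex.inv_re]
    have : (1 + 4 * Complex.I * s : ℂ) ≠ 0 := fun h => by simpa using congrArg Complex.re h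
    have := Complex.normSq_pos.2 this
    simp only [Complex.add_re, Complex.one_re, Complex.mul_re, Complex.I_re, Complex.mul_im,
      Complex.I_im, Complex.ofReal_re, Complex.ofReal_im]
    simpa using this
  have hD : (1 + 4 * Complex.I * s : ℂ) ≠ 0 := fun h => by simp [h] at ha
  -- The initial width that the flow carries to width 1: here `E = a`, hence `a / E = 1`.
  set a : ℂ := 1 / (1 + 4 * Complex.I * s) with ha'
  have hE : a = 1 - 4 * Complex.I * a * s := by
    rw [ha']; field_simp; ring
  have ha0 : a ≠ 0 := one_div_ne_zero hD
  have hc' : c ≠ 0 := by rintro rfl; simp at hc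
  have hae := ae_eq_of_gaussPair_eq (a := 1) (by simp) G u
    (c * Complex.exp (Complex.I * ((-s⁻¹ * ∑ i, l i ^ 2 : ℝ) : ℂ)))
    (fun i => ((s⁻¹ * l i : ℝ) : ℂ)) (fun b => by
      have := (gaussPair_shift_iff (inv_mul_cancel₀ hs) hu hG l ha hE c (fun i => b i * a)).1
        (hsh a ha _)
      simpa only [div_self ha0, mul_div_cancel_right₀ _ ha0] using this)
  rw [← hG.eLpNorm_eq, expNorm]
  refine eLpNorm_congr_norm_ae ?_
  filter_upwards [hae] with x hx
  rw [hx, norm_mul (c * _), norm_mul c, hc, norm_cexp_I_mul, one_mul, one_mul]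

/-- The endpoint κ = 0, corresponding to infinite time: since D acts as 2πη under `𝓕`, the operator
e^{2l·D} becomes multiplication by e^{4πl·η}. -/
lemma isPhaseShiftNorm_fourier (v : L2Space n) (l : Fin n → ℝ) :
    IsPhaseShiftNorm v l 0 (expNorm (fun i => 4 * Real.pi * l i) (𝓕 v : L2Space n)) := by
  constructor
  · intro hN
    have hm : MemLp (fun x => gauss 0 (fun i => ((4 * Real.pi * l i : ℝ) : ℂ)) x *
        (𝓕 v : L2Space n) x) 2 volume := ⟨aestronglyMeasurable_gauss_mul _ _, hN.lt_top⟩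
    set h : L2Space n := 𝓕⁻ (hm.toLp _) with hh
    have hF : 𝓕 h = hm.toLp _ := by rw [hh, FourierTransform.fourier_fourierInv_eq]
    refine ⟨h, ⟨1, by simp, fun a ha b => ?_⟩, ?_⟩
    · have ha0 : a ≠ 0 := by rintro rfl; simp at ha
      obtain ⟨C, hC, hev⟩ := gaussPair_eq_fourier (n := n) ha
      have k1 := hev h b
      have k2 := hev v (fun i => b i + (0 : ℝ) * l i - 4 * Complex.I * a * l i)
      rw [hF, gaussPair_congr hm.coeFn_toLp, gaussPair_gauss_mul, add_zero] at k1
      have e1 : ((fun i => Real.pi * Complex.I * b i / a) +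
          fun i => ((4 * Real.pi * l i : ℝ) : ℂ)) =
          fun i => Real.pi * Complex.I * (b i + (0 : ℝ) * l i - 4 * Complex.I * a * l i) / a := by
        ext i
        simp only [Pi.add_apply]
        field_simp
        push_cast
        linear_combination (4 * Real.pi * a * l i) * Complex.I_sq
      rw [e1, k2] at k1
      have e2 : Complex.exp
          (-(∑ i, (b i + (0 : ℝ) * l i - 4 * Complex.I * a * l i) ^ 2) / (4 * a)) =
          Complex.exp (-(∑ i, b i ^ 2) / (4 * a)) *
          Complex.exp (4 * a * ∑ i, (l i : ℂ) ^ 2 + 2 * Complex.I * ∑ i, b i * l i) := by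
        rw [← Complex.exp_add]
        congr 1
        have : ∀ i, (b i + (0 : ℝ) * l i - 4 * Complex.I * a * l i) ^ 2 =
            b i ^ 2 - (8 * Complex.I * a) * (b i * l i) - (16 * a ^ 2) * (l i : ℂ) ^ 2 := by
          intro i
          push_cast
          linear_combination (16 * a ^ 2 * (l i : ℂ) ^ 2) * Complex.I_sq
        simp only [this, Finset.sum_sub_distrib, ← Finset.mul_sum]
        field_simp
        ring
      rw [e2] at k1
      have := Complex.exp_ne_zero (-(∑ i, b i ^ 2) / (4 * a))
      refine mul_left_cancel₀ (mul_ne_zero hC this) ?_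
      rw [← k1]
      ring
    · have := Lp.norm_fourier_eq h
      rw [hF, Lp.norm_def, Lp.norm_def, ENNReal.toReal_eq_toReal_iff' (Lp.eLpNorm_ne_top _)
        (Lp.eLpNorm_ne_top _), eLpNorm_congr_ae hm.coeFn_toLp] at this
      exact this.symm
  · intro hN
    have := eq_zero_of_expNorm_eq_zero hN
    rwa [← norm_eq_zero, Lp.norm_fourier_eq, norm_eq_zero] at this

/-- Logarithmic convexity of linear exponential weights along the free flow. -/
lemma expNorm_le_of_isPhaseShiftNorm {s κ₀ κ₁ θ : ℝ} (hs : s ≠ 0) {v u : L2Space n}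
    (hu : IsFreeEvolution s v u) {l : Fin n → ℝ} {N₀ N₁ : ℝ≥0∞}
    (h₀ : IsPhaseShiftNorm v l κ₀ N₀) (h₁ : IsPhaseShiftNorm v l κ₁ N₁)
    (hθ : 0 < θ) (hθ' : θ < 1) (hκ : s⁻¹ = θ * κ₀ + (1 - θ) * κ₁) :
    expNorm (fun i => s⁻¹ * l i) u ≤ N₀ ^ θ * N₁ ^ (1 - θ) := by
  have hθ1 : 0 < 1 - θ := by linarith
  -- Zero must be settled before ∞, because 0 · ∞ = 0 makes the right side vanish; then `v`, and
  -- with it `u`, vanishes too.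
  by_cases hz : N₀ = 0 ∨ N₁ = 0
  · have hv : v = 0 := hz.elim h₀.2 h₁.2
    have hu0 : u = 0 := hu.symm.eq_zero hv
    have : expNorm (fun i => s⁻¹ * l i) u = 0 := by
      rw [expNorm, eLpNorm_eq_zero_iff (aestronglyMeasurable_gauss_mul _ u) two_ne_zero]
      filter_upwards [(Lp.eq_zero_iff_ae_eq_zero).1 hu0] with x hx
      simp [hx]
    rw [this]
    exact zero_le
  push Not at hz
  by_cases ht : N₀ = ∞ ∨ N₁ = ∞
  · have : N₀ ^ θ * N₁ ^ (1 - θ) = ∞ := by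
      rcases ht with ht | ht
      · rw [ht, ENNReal.top_rpow_of_pos hθ, ENNReal.top_mul]
        simp [ENNReal.rpow_eq_zero_iff, hz.2, hθ'.le]
      · rw [ht, ENNReal.top_rpow_of_pos hθ1, ENNReal.mul_top]
        simp [ENNReal.rpow_eq_zero_iff, hz.1, hθ.le]
    rw [this]
    exact le_top
  push Not at ht
  obtain ⟨g₀, hg₀, rfl⟩ := h₀.1 ht.1
  obtain ⟨g₁, hg₁, rfl⟩ := h₁.1 ht.2
  obtain ⟨h, hh, hle⟩ := hg₀.exists_interpolation hg₁ hθ.le hθ'.le hκ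
  rwa [hh.expNorm_eq hs hu]

end LogConvexity

/-! ### Distributional solutions follow the Fourier multiplier flow. -/

section Schrodinger

variable {n : ℕ}

lemma norm_exp_I_mul_sub_one_sub_le (x : ℝ) :
    ‖Complex.exp (Complex.I * x) - 1 - Complex.I * x‖ ≤ 2 * x ^ 2 := by
  have hn : ‖Complex.I * (x : ℂ)‖ = |x| := by simp
  rcases le_total |x| 1 with h | h
  · refine (Complex.norm_exp_sub_one_sub_id_le (by rwa [hn])).trans ?_
    rw [hn, sq_abs]
    nlinarith [sq_nonneg x]
  · refine (norm_sub_le _ _).trans ?_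
    have := Real.norm_exp_I_mul_ofReal_sub_one_le (x := x)
    rw [Real.norm_eq_abs] at this
    rw [hn]
    nlinarith [sq_abs x]

lemma IsFreeSchrodingerSolution.hasDerivAt_fourier {u : ℝ → L2Space n}
    (hu : IsFreeSchrodingerSolution u) {t : ℝ} (ht : 0 < t)
    (Ψ : 𝓢(EuclideanSpace ℝ (Fin n), ℂ)) :
    HasDerivAt (fun s => ∫ ξ, Ψ ξ * (𝓕 (u s) : L2Space n) ξ)
      (-(Complex.I * (2 * Real.pi) ^ 2) *
        ∫ ξ, (‖ξ‖ ^ 2 : ℝ) * Ψ ξ * (𝓕 (u t) : L2Space n) ξ) t := by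
  have h1 : ∀ s, Lp.toTemperedDistribution (u s) (𝓕 Ψ) =
      ∫ ξ, Ψ ξ * (𝓕 (u s) : L2Space n) ξ := fun s => by
    rw [← TemperedDistribution.fourier_apply, Lp.fourier_toTemperedDistribution_eq,
      Lp.toTemperedDistribution_apply]
    rfl
  have h2 := hu.hasDerivAt t ht (𝓕 Ψ)
  simp only [h1] at h2
  convert h2 using 1
  rw [TemperedDistribution.laplacian_eq_fourierMultiplierCLM]
  have hT : (fun x : EuclideanSpace ℝ (Fin n) => ((‖x‖ ^ 2 : ℝ) : ℂ)).HasTemperateGrowth := by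
    fun_prop
  have h3 : (TemperedDistribution.fourierMultiplierCLM ℂ
      (fun x : EuclideanSpace ℝ (Fin n) => ((‖x‖ ^ 2 : ℝ) : ℂ)) (Lp.toTemperedDistribution (u t)))
      (𝓕 Ψ) = ∫ ξ, (‖ξ‖ ^ 2 : ℝ) * Ψ ξ * (𝓕 (u t) : L2Space n) ξ := by
    rw [TemperedDistribution.fourierMultiplierCLM_apply_apply, FourierTransform.fourierInv_fourier_eq,
      ← TemperedDistribution.fourier_apply, Lp.fourier_toTemperedDistribution_eq,
      Lp.toTemperedDistribution_apply]
    simp only [SchwartzMap.smulLeftCLM_apply_apply hT, smul_eq_mul]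
  have h4 : ∀ (c : ℝ) (T : 𝓢'(EuclideanSpace ℝ (Fin n), ℂ)) (φ : 𝓢(EuclideanSpace ℝ (Fin n), ℂ)),
      (c • T) φ = c * T φ := fun c T φ => by
    simp
  rw [h4, h3]
  push_cast
  ring

/-- A test function moved by the conjugate Schrödinger multiplier. -/
noncomputable def evolvedTest (ψ : EuclideanSpace ℝ (Fin n) → ℝ) (s : ℝ)
    (ξ : EuclideanSpace ℝ (Fin n)) : ℂ :=
  gauss (4 * Real.pi ^ 2 * s * Complex.I) 0 ξ * ψ ξ

lemma memLp_mul_evolvedTest {ψ : EuclideanSpace ℝ (Fin n) → ℝ} (hψ : Continuous ψ)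
    (hc : HasCompactSupport ψ) (s : ℝ) {k : EuclideanSpace ℝ (Fin n) → ℂ} (hk : Continuous k) :
    MemLp (fun ξ => k ξ * evolvedTest ψ s ξ) 2 volume := by
  refine Continuous.memLp_of_hasCompactSupport ?_ ?_
  · have := continuous_gauss (n := n) (4 * Real.pi ^ 2 * s * Complex.I) 0
    unfold evolvedTest
    fun_prop
  · have : HasCompactSupport (fun ξ => (ψ ξ : ℂ)) := hc.comp_left (g := Complex.ofReal) rfl
    exact (this.mul_left (f := gauss (4 * Real.pi ^ 2 * s * Complex.I) 0)).mul_left (f := k)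

lemma memLp_evolvedTest {ψ : EuclideanSpace ℝ (Fin n) → ℝ} (hψ : Continuous ψ)
    (hc : HasCompactSupport ψ) (s : ℝ) : MemLp (evolvedTest ψ s) 2 volume := by
  simpa using memLp_mul_evolvedTest hψ hc s (k := fun _ => 1) continuous_const

lemma gauss_I_eq (s : ℝ) (ξ : EuclideanSpace ℝ (Fin n)) :
    gauss (4 * Real.pi ^ 2 * s * Complex.I) 0 ξ =
      Complex.exp (Complex.I * ((-(4 * Real.pi ^ 2 * ‖ξ‖ ^ 2 * s) : ℝ) : ℂ)) := by
  rw [gauss, EuclideanSpace.real_norm_sq_eq]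
  simp only [Pi.zero_apply, zero_mul, Finset.sum_const_zero, add_zero]
  push_cast
  congr 1
  ring

/-- The second-order Taylor remainder of the phase is at most (r - t)² times a fixed compactly
supported continuous function, so differentiation holds in L² norm. -/
lemma hasDerivAt_evolvedTest {ψ : EuclideanSpace ℝ (Fin n) → ℝ} (hψ : Continuous ψ)
    (hc : HasCompactSupport ψ) (t : ℝ) :
    HasDerivAt (fun s => (memLp_evolvedTest hψ hc s).toLp (evolvedTest ψ s))
      ((memLp_mul_evolvedTest hψ hc t (k := fun ξ => -(4 * Real.pi ^ 2 * Complex.I) * (‖ξ‖ ^ 2 : ℝ))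
        (by fun_prop)).toLp _) t := by
  have hk : MemLp (fun ξ => (2 * (4 * Real.pi ^ 2 * ‖ξ‖ ^ 2) ^ 2 : ℝ) * evolvedTest ψ 0 ξ)
      2 volume := memLp_mul_evolvedTest hψ hc 0 (by fun_prop)
  rw [hasDerivAt_iff_isLittleO]
  have hO : (fun r => (memLp_evolvedTest hψ hc r).toLp (evolvedTest ψ r) -
      (memLp_evolvedTest hψ hc t).toLp (evolvedTest ψ t) - (r - t) •
      (memLp_mul_evolvedTest hψ hc t (k := fun ξ => -(4 * Real.pi ^ 2 * Complex.I) * (‖ξ‖ ^ 2 : ℝ))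
        (by fun_prop)).toLp _) =O[nhds t] fun r => ‖r - t‖ ^ 2 := by
    refine Asymptotics.IsBigO.of_bound ‖hk.toLp _‖ (Filter.Eventually.of_forall fun r => ?_)
    rw [norm_pow, norm_norm, Real.norm_eq_abs, sq_abs]
    refine (Lp.norm_le_mul_norm_of_ae_le_mul (c := (r - t) ^ 2) (g := hk.toLp _) ?_).trans_eq
      (mul_comm _ _)
    filter_upwards [Lp.coeFn_sub ((memLp_evolvedTest hψ hc r).toLp (evolvedTest ψ r) -
      (memLp_evolvedTest hψ hc t).toLp (evolvedTest ψ t)) ((r - t) •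
      (memLp_mul_evolvedTest hψ hc t (k := fun ξ => -(4 * Real.pi ^ 2 * Complex.I) * (‖ξ‖ ^ 2 : ℝ))
        (by fun_prop)).toLp _),
      Lp.coeFn_sub ((memLp_evolvedTest hψ hc r).toLp (evolvedTest ψ r))
      ((memLp_evolvedTest hψ hc t).toLp (evolvedTest ψ t)),
      Lp.coeFn_smul (r - t) ((memLp_mul_evolvedTest hψ hc t
        (k := fun ξ => -(4 * Real.pi ^ 2 * Complex.I) * (‖ξ‖ ^ 2 : ℝ)) (by fun_prop)).toLp _),
      (memLp_evolvedTest hψ hc r).coeFn_toLp, (memLp_evolvedTest hψ hc t).coeFn_toLp,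
      (memLp_mul_evolvedTest hψ hc t (k := fun ξ => -(4 * Real.pi ^ 2 * Complex.I) * (‖ξ‖ ^ 2 : ℝ))
        (by fun_prop)).coeFn_toLp, hk.coeFn_toLp] with ξ e1 e2 e3 e4 e5 e6 e7
    rw [e1, Pi.sub_apply, e2, Pi.sub_apply, e3, Pi.smul_apply, e4, e5, e6, e7]
    simp only [evolvedTest, gauss_I_eq]
    set m : ℝ := 4 * Real.pi ^ 2 * ‖ξ‖ ^ 2 with hm
    have e8 : Complex.exp (Complex.I * ((-(m * r) : ℝ) : ℂ)) =
        Complex.exp (Complex.I * ((-(m * t) : ℝ) : ℂ)) *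
          Complex.exp (Complex.I * ((-(m * (r - t)) : ℝ) : ℂ)) := by
      rw [← Complex.exp_add]; congr 1; push_cast; ring
    have e9 : Complex.exp (Complex.I * ((-(m * r) : ℝ) : ℂ)) * ψ ξ -
        Complex.exp (Complex.I * ((-(m * t) : ℝ) : ℂ)) * ψ ξ -
        (r - t) • (-(4 * Real.pi ^ 2 * Complex.I) * (‖ξ‖ ^ 2 : ℝ) *
          (Complex.exp (Complex.I * ((-(m * t) : ℝ) : ℂ)) * ψ ξ)) =
        Complex.exp (Complex.I * ((-(m * t) : ℝ) : ℂ)) * ψ ξ *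
        (Complex.exp (Complex.I * ((-(m * (r - t)) : ℝ) : ℂ)) - 1 -
          Complex.I * ((-(m * (r - t)) : ℝ) : ℂ)) := by
      rw [e8, Complex.real_smul, hm]; push_cast; ring
    rw [e9, norm_mul, norm_mul, norm_mul, norm_mul, norm_cexp_I_mul, norm_cexp_I_mul]
    have hb := norm_exp_I_mul_sub_one_sub_le (-(m * (r - t)))
    rw [Complex.norm_of_nonneg (by positivity : (0:ℝ) ≤ 2 * m ^ 2), one_mul]
    calc _ ≤ ‖(ψ ξ : ℂ)‖ * (2 * (-(m * (r - t))) ^ 2) := by gcongr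
      _ = _ := by ring
  exact hO.trans_isLittleO (Asymptotics.isLittleO_pow_sub_sub t one_lt_two)

lemma continuous_evolvedTest {ψ : EuclideanSpace ℝ (Fin n) → ℝ} (hψ : Continuous ψ)
    (hc : HasCompactSupport ψ) :
    Continuous (fun s => (memLp_evolvedTest hψ hc s).toLp (evolvedTest ψ s)) :=
  continuous_iff_continuousAt.2 fun t => (hasDerivAt_evolvedTest hψ hc t).continuousAt

lemma inner_toLp_eq {k : EuclideanSpace ℝ (Fin n) → ℂ} (hk : MemLp k 2 volume) (f : L2Space n) :
    inner ℂ (hk.toLp k) f = ∫ ξ, (starRingEnd ℂ) (k ξ) * f ξ := by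
  rw [L2.inner_def]
  refine integral_congr_ae ?_
  filter_upwards [hk.coeFn_toLp] with x hx
  rw [hx]
  simp [mul_comm]

lemma conj_gauss_I (s : ℝ) (ξ : EuclideanSpace ℝ (Fin n)) :
    (starRingEnd ℂ) (gauss (4 * Real.pi ^ 2 * s * Complex.I) 0 ξ) =
      gauss (4 * Real.pi ^ 2 * (-s : ℝ) * Complex.I) 0 ξ := by
  rw [gauss_I_eq, gauss_I_eq, ← Complex.exp_conj]
  congr 1
  rw [map_mul, Complex.conj_I, Complex.conj_ofReal]
  push_cast
  ring

lemma inner_real_smul_left (r : ℝ) (f g : L2Space n) :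
    inner ℂ (r • f) g = (r : ℂ) * inner ℂ f g := by
  rw [← algebraMap_smul ℂ r f, inner_smul_left]
  simp

/-- The test function moves with the same multiplier as the solution, so the two contributions to
the derivative cancel. -/
lemma IsFreeSchrodingerSolution.hasDerivAt_inner {u : ℝ → L2Space n}
    (hu : IsFreeSchrodingerSolution u) {ψ : EuclideanSpace ℝ (Fin n) → ℝ}
    (hψ : ContDiff ℝ (⊤ : ℕ∞) ψ) (hc : HasCompactSupport ψ) {t : ℝ} (ht : 0 < t) :
    HasDerivAt (fun s => inner ℂ ((memLp_evolvedTest hψ.continuous hc s).toLp (evolvedTest ψ s))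
      (𝓕 (u s) : L2Space n)) 0 t := by
  set P : ℝ → L2Space n := fun s =>
    (memLp_evolvedTest hψ.continuous hc s).toLp (evolvedTest ψ s) with hP
  have hΨ : ContDiff ℝ (⊤ : ℕ∞) (fun ξ => (starRingEnd ℂ) (evolvedTest ψ t ξ)) := by
    have h1 : ContDiff ℝ (⊤ : ℕ∞) (fun ξ => Complex.ofRealCLM (ψ ξ)) := by fun_prop
    have h2 : ContDiff ℝ (⊤ : ℕ∞)
        (fun ξ : EuclideanSpace ℝ (Fin n) => gauss (4 * Real.pi ^ 2 * t * Complex.I) 0 ξ) := by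
      simp only [gauss_I_eq]
      refine ContDiff.cexp (contDiff_const.mul ?_)
      exact Complex.ofRealCLM.contDiff.comp ((contDiff_const.mul (contDiff_norm_sq ℝ)).mul contDiff_const).neg
    exact Complex.conjCLE.contDiff.comp (h2.mul h1)
  have hcΨ : HasCompactSupport (fun ξ => (starRingEnd ℂ) (evolvedTest ψ t ξ)) := by
    have : HasCompactSupport (fun ξ => (ψ ξ : ℂ)) := hc.comp_left (g := Complex.ofReal) rfl
    exact (this.mul_left (f := gauss (4 * Real.pi ^ 2 * t * Complex.I) 0)).comp_left
      (g := starRingEnd ℂ) (map_zero _)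
  have hw : ContinuousAt (fun s => (𝓕 (u s) : L2Space n)) t :=
    (Lp.fourierTransformₗᵢ (EuclideanSpace ℝ (Fin n)) ℂ).continuous.continuousAt.comp
      (hu.continuousOn.continuousAt (Ici_mem_nhds ht))
  have d1 : HasDerivAt (fun s => inner ℂ (P t) (𝓕 (u s) : L2Space n))
      (-(Complex.I * (2 * Real.pi) ^ 2) * ∫ ξ, (‖ξ‖ ^ 2 : ℝ) *
        (starRingEnd ℂ) (evolvedTest ψ t ξ) * (𝓕 (u t) : L2Space n) ξ) t := by
    have := hu.hasDerivAt_fourier ht (hcΨ.toSchwartzMap hΨ)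
    simpa only [hP, inner_toLp_eq, HasCompactSupport.toSchwartzMap_toFun] using this
  -- As `u` is only weakly differentiable, the product rule is split: `P t` is frozen for the
  -- equation, and here the strong derivative of `P` meets mere continuity of `u`.
  have d2 : HasDerivAt (fun s => inner ℂ (P s - P t) (𝓕 (u s) : L2Space n))
      (inner ℂ ((memLp_mul_evolvedTest hψ.continuous hc t
        (k := fun ξ => -(4 * Real.pi ^ 2 * Complex.I) * (‖ξ‖ ^ 2 : ℝ)) (by fun_prop)).toLp _)
        (𝓕 (u t) : L2Space n)) t := by
    rw [hasDerivAt_iff_tendsto_slope]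
    have hs := (hasDerivAt_iff_tendsto_slope.1 (hasDerivAt_evolvedTest hψ.continuous hc t)).inner
      (𝕜 := ℂ) (hw.tendsto.mono_left nhdsWithin_le_nhds)
    refine hs.congr fun r => ?_
    rw [slope_def_module, slope_def_module, sub_self, inner_zero_left, sub_zero,
      inner_real_smul_left, Complex.real_smul]
  have d3 := d1.add d2
  have e : ∀ s, inner ℂ (P s) (𝓕 (u s) : L2Space n) =
      inner ℂ (P t) (𝓕 (u s) : L2Space n) + inner ℂ (P s - P t) (𝓕 (u s) : L2Space n) := by
    intro s
    rw [inner_sub_left]; ring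
  refine (d3.congr_deriv ?_).congr_of_eventuallyEq (Filter.Eventually.of_forall e)
  rw [inner_toLp_eq, ← integral_const_mul, ← neg_eq_iff_add_eq_zero, ← integral_neg]
  refine integral_congr_ae (Filter.Eventually.of_forall fun ξ => ?_)
  simp only [map_mul, map_neg, map_pow, Complex.conj_I, Complex.conj_ofReal, map_ofNat]
  push_cast
  ring

/-- Pairings with evolved test functions are constant for positive times, and continuity at 0 brings
in the initial value. Test functions then separate the two sides. -/
lemma IsFreeSchrodingerSolution.isFreeEvolution {u : ℝ → L2Space n}
    (hu : IsFreeSchrodingerSolution u) {t : ℝ} (ht : 0 ≤ t) : IsFreeEvolution t (u 0) (u t) := by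
  have hconst : ∀ {ψ : EuclideanSpace ℝ (Fin n) → ℝ} (hψ : ContDiff ℝ (⊤ : ℕ∞) ψ)
      (hc : HasCompactSupport ψ),
      inner ℂ ((memLp_evolvedTest hψ.continuous hc t).toLp (evolvedTest ψ t)) (𝓕 (u t) : L2Space n)
      = inner ℂ ((memLp_evolvedTest hψ.continuous hc 0).toLp (evolvedTest ψ 0))
        (𝓕 (u 0) : L2Space n) := by
    intro ψ hψ hc
    set g : ℝ → ℂ := fun s => inner ℂ ((memLp_evolvedTest hψ.continuous hc s).toLp
      (evolvedTest ψ s)) (𝓕 (u s) : L2Space n) with hg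
    have hd : ∀ s, 0 < s → HasDerivAt g 0 s := fun s hs => hu.hasDerivAt_inner hψ hc hs
    have hcont : ContinuousWithinAt g (Set.Ici 0) 0 := by
      refine ContinuousWithinAt.inner (𝕜 := ℂ) (continuous_evolvedTest hψ.continuous hc).continuousWithinAt
        ?_
      exact (Lp.fourierTransformₗᵢ (EuclideanSpace ℝ (Fin n)) ℂ).continuous.continuousAt.comp_continuousWithinAt
        (hu.continuousOn 0 Set.self_mem_Ici)
    have hev : ∀ s ∈ Set.Ioi (0 : ℝ), g s = g 1 := by
      intro s hs
      refine (convex_Ioi (0 : ℝ)).is_const_of_fderivWithin_eq_zero (𝕜 := ℝ) (f := g)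
        (fun x hx => (hd x hx).differentiableAt.differentiableWithinAt) (fun x hx => ?_) hs
        (Set.mem_Ioi.2 one_pos)
      rw [fderivWithin_of_isOpen isOpen_Ioi hx]
      ext
      simpa using (hd x hx).deriv
    have h0 : g 0 = g 1 := by
      refine tendsto_nhds_unique (f := g) (l := nhdsWithin 0 (Set.Ioi 0))
        (hcont.mono Set.Ioi_subset_Ici_self) ?_
      refine tendsto_const_nhds.congr' ?_
      filter_upwards [self_mem_nhdsWithin] with s hs
      exact (hev s hs).symm
    rcases ht.eq_or_lt with rfl | ht'
    · rfl
    · exact (hev t ht').trans h0.symm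
  have hae : ∀ᵐ ξ, gauss (4 * Real.pi ^ 2 * (-t : ℝ) * Complex.I) 0 ξ * (𝓕 (u t) : L2Space n) ξ =
      (𝓕 (u 0) : L2Space n) ξ := by
    have hm : MemLp (fun ξ => gauss (4 * Real.pi ^ 2 * (-t : ℝ) * Complex.I) 0 ξ *
        (𝓕 (u t) : L2Space n) ξ) 2 volume := by
      obtain ⟨g, hg⟩ := exists_isFreeEvolution (-t) (u t)
      exact (memLp_congr_ae hg).1 (Lp.memLp (𝓕 g : L2Space n))
    refine ae_eq_of_integral_contDiff_smul_eq (hm.locallyIntegrable (by norm_num))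
      ((Lp.memLp (𝓕 (u 0) : L2Space n)).locallyIntegrable (by norm_num)) fun ψ hψ hc => ?_
    have := hconst hψ hc
    rw [inner_toLp_eq, inner_toLp_eq] at this
    simp only [evolvedTest, map_mul, conj_gauss_I, Complex.conj_ofReal] at this
    convert this using 3 with ξ ξ
    · rw [Complex.real_smul]; ring
    · rw [Complex.real_smul]; simp [gauss]
  filter_upwards [hae] with ξ hξ
  rw [← hξ, ← mul_assoc, ← gauss_add]
  simp [gauss]

end Schrodinger

/-! ### Superposition of tangent exponentials. -/

section Subordination

/-- The slope of the tangent to `|y|^p` parametrised so that the Bregman divergence is comparable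
to a square. -/
noncomputable def tangentSlope (p s : ℝ) : ℝ := p * (SignType.sign s : ℝ) * |s| ^ (2 - 2 / p)

/-- Exponentials of tangents to `|y|^p`. -/
noncomputable def tangentExp (p y s : ℝ) : ℝ := Real.exp (tangentSlope p s * y - (p - 1) * s ^ 2)

/-- The line in the middle is the tangent to y^p at the point s^{2/p}. With x = y^{p/2}/s both
bounds become Bernoulli inequalities, convex for x^{2/p} and concave for x^{2/p-1}; this uses 1 ≤
2/p ≤ 2. -/
lemma tangent_bounds {p : ℝ} (hp : 1 < p) (hp2 : p ≤ 2) {s y : ℝ} (hs : 0 ≤ s) (hy : 0 ≤ y) :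
    y ^ p - (s - y ^ (p / 2)) ^ 2 ≤ p * s ^ (2 - 2 / p) * y - (p - 1) * s ^ 2 ∧
    p * s ^ (2 - 2 / p) * y - (p - 1) * s ^ 2 ≤ y ^ p - (p - 1) * (s - y ^ (p / 2)) ^ 2 := by
  have hp0 : 0 < p := by linarith
  set σ := y ^ (p / 2) with hσ
  have hσ0 : 0 ≤ σ := Real.rpow_nonneg hy _
  have hyp : y ^ p = σ ^ 2 := by
    rw [hσ, ← Real.rpow_natCast, ← Real.rpow_mul hy]; norm_num
  rw [hyp]
  rcases hs.eq_or_lt with rfl | hs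
  · have : 2 / p < 2 := by rw [div_lt_iff₀ hp0]; linarith
    rw [Real.zero_rpow (by linarith)]
    constructor <;> nlinarith [sq_nonneg σ]
  · set x := σ / s with hx
    have hx0 : 0 ≤ x := by positivity
    have hσx : σ = s * x := by rw [hx]; field_simp
    have hyx : y = s ^ (2 / p) * x ^ (2 / p) := by
      rw [← Real.mul_rpow hs.le hx0, ← hσx, hσ, ← Real.rpow_mul hy]
      have : p / 2 * (2 / p) = 1 := by field_simp
      rw [this, Real.rpow_one]
    have e : p * s ^ (2 - 2 / p) * y = p * s ^ 2 * x ^ (2 / p) := by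
      have : s ^ (2 - 2 / p) * s ^ (2 / p) = s ^ 2 := by
        rw [← Real.rpow_add hs, sub_add_cancel]; norm_num
      rw [hyx, ← this]; ring
    have hr1 : 1 ≤ 2 / p := by rw [le_div_iff₀ hp0]; linarith
    have hr2 : 2 / p - 1 ≤ 1 := by
      have : 2 / p ≤ 2 := by rw [div_le_iff₀ hp0]; linarith
      linarith
    have h1 := one_add_mul_self_le_rpow_one_add (s := x - 1) (by linarith) hr1
    have h2 := rpow_one_add_le_one_add_mul_self (s := x - 1) (by linarith)
      (p := 2 / p - 1) (by linarith) hr2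
    rw [add_sub_cancel] at h1 h2
    have h3 : x ^ (2 / p) ≤ x * (1 + (2 / p - 1) * (x - 1)) := by
      rcases hx0.eq_or_lt with h0 | h0
      · rw [← h0, Real.zero_rpow (by linarith), zero_mul]
      · calc x ^ (2 / p) = x * x ^ (2 / p - 1) := by
              rw [Real.rpow_sub_one h0.ne']; field_simp
          _ ≤ _ := by gcongr
    have hps : 0 ≤ p * s ^ 2 := by positivity
    have h1' := mul_le_mul_of_nonneg_left h1 hps
    have h3' := mul_le_mul_of_nonneg_left h3 hps
    have e1 : p * s ^ 2 * (1 + 2 / p * (x - 1)) = p * s ^ 2 + 2 * s ^ 2 * (x - 1) := by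
      field_simp
    have e3 : p * s ^ 2 * (x * (1 + (2 / p - 1) * (x - 1))) =
        p * s ^ 2 * x + (2 - p) * s ^ 2 * x * (x - 1) := by
      field_simp
    rw [e1] at h1'
    rw [e3] at h3'
    rw [e, hσx]
    constructor <;> nlinarith

lemma tangentExp_neg (p y s : ℝ) : tangentExp p (-y) (-s) = tangentExp p y s := by
  simp only [tangentExp, tangentSlope, Left.sign_neg, abs_neg]
  congr 1
  have : ((-SignType.sign s : SignType) : ℝ) = -((SignType.sign s : SignType) : ℝ) := by
    rcases lt_trichotomy s 0 with h | h | h <;> simp [h]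
  rw [this]
  ring

lemma tangentSlope_of_nonneg {p : ℝ} (hp : 1 < p) {s : ℝ} (hs : 0 ≤ s) :
    tangentSlope p s = p * s ^ (2 - 2 / p) := by
  have : 2 / p < 2 := by rw [div_lt_iff₀ (by linarith)]; linarith
  rcases hs.eq_or_lt with rfl | hs
  · rw [Real.zero_rpow (by linarith)]; simp [tangentSlope]
  · simp [tangentSlope, sign_pos hs, abs_of_pos hs]

lemma tangentSlope_neg (p s : ℝ) : tangentSlope p (-s) = -tangentSlope p s := by
  simp only [tangentSlope, Left.sign_neg, abs_neg]
  have : ((-SignType.sign s : SignType) : ℝ) = -((SignType.sign s : SignType) : ℝ) := by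
    rcases lt_trichotomy s 0 with h | h | h <;> simp [h]
  rw [this]
  ring

lemma measurable_tangentSlope (p : ℝ) : Measurable (tangentSlope p) := by
  have h : Measurable (fun s : ℝ => ((SignType.sign s : SignType) : ℝ)) := by
    have : (fun s : ℝ => ((SignType.sign s : SignType) : ℝ)) =
        fun s => if 0 < s then 1 else if s < 0 then -1 else 0 := by
      ext s
      rcases lt_trichotomy s 0 with h | h | h
      · simp [h, h.not_gt]
      · simp [h]
      · simp [h]
    rw [this]
    exact Measurable.ite measurableSet_Ioi measurable_const
      (Measurable.ite measurableSet_Iio measurable_const measurable_const)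
  unfold tangentSlope
  exact (h.const_mul p).mul (by fun_prop)

lemma measurable_tangentExp (p y : ℝ) : Measurable (tangentExp p y) := by
  have := measurable_tangentSlope p
  unfold tangentExp
  fun_prop

/-- For negative `s` the slope is nonpositive, so replacing `s` by `-s` only increases the
exponential; the second Gaussian covers this case. -/
lemma tangentExp_le_of_nonneg {p : ℝ} (hp : 1 < p) (hp2 : p ≤ 2) {y : ℝ} (hy : 0 ≤ y) (s : ℝ) :
    tangentExp p y s ≤ Real.exp (y ^ p) * (Real.exp (-(p - 1) * (s - y ^ (p / 2)) ^ 2) +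
      Real.exp (-(p - 1) * (s - -y ^ (p / 2)) ^ 2)) := by
  rw [mul_add, ← Real.exp_add, ← Real.exp_add, tangentExp]
  rcases le_total 0 s with hs | hs
  · have := (tangent_bounds hp hp2 hs hy).2
    refine le_add_of_le_of_nonneg (Real.exp_le_exp.2 ?_) (Real.exp_pos _).le
    rw [tangentSlope_of_nonneg hp hs]
    linarith
  · have hs' : 0 ≤ -s := by linarith
    have := (tangent_bounds hp hp2 hs' hy).2
    refine le_add_of_nonneg_of_le (Real.exp_pos _).le (Real.exp_le_exp.2 ?_)
    have h1 : tangentSlope p s ≤ tangentSlope p (-s) := by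
      have h2 := tangentSlope_neg p s
      have h3 : 0 ≤ tangentSlope p (-s) := by
        rw [tangentSlope_of_nonneg hp hs']; positivity
      linarith
    rw [tangentSlope_of_nonneg hp hs'] at h1
    nlinarith [mul_le_mul_of_nonneg_right h1 hy]

lemma integrable_exp_sq {a : ℝ} (ha : 0 < a) (σ : ℝ) :
    Integrable (fun s : ℝ => Real.exp (-a * (s - σ) ^ 2)) :=
  (integrable_exp_neg_mul_sq ha).comp_sub_right σ

lemma tangentExp_integral_of_nonneg {p : ℝ} (hp : 1 < p) (hp2 : p ≤ 2) {y : ℝ} (hy : 0 ≤ y) :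
    Integrable (tangentExp p y) ∧ Real.exp (-1) * Real.exp (y ^ p) ≤ ∫ s, tangentExp p y s ∧
      ∫ s, tangentExp p y s ≤ 2 * √(Real.pi / (p - 1)) * Real.exp (y ^ p) := by
  have hp1 : 0 < p - 1 := by linarith
  have i1 := integrable_exp_sq hp1 (y ^ (p / 2))
  have i2 := integrable_exp_sq hp1 (-y ^ (p / 2))
  have hi : Integrable (tangentExp p y) := by
    refine ((i1.add i2).const_mul (Real.exp (y ^ p))).mono'
      (measurable_tangentExp p y).aestronglyMeasurable (Filter.Eventually.of_forall fun s => ?_)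
    rw [Real.norm_eq_abs, tangentExp, Real.abs_exp]
    exact tangentExp_le_of_nonneg hp hp2 hy s
  refine ⟨hi, ?_, ?_⟩
  · set σ := y ^ (p / 2) with hσ
    have hσ0 : 0 ≤ σ := Real.rpow_nonneg hy _
    calc Real.exp (-1) * Real.exp (y ^ p)
        = ∫ s in Set.Icc σ (σ + 1), Real.exp (-1) * Real.exp (y ^ p) := by simp
      _ ≤ ∫ s in Set.Icc σ (σ + 1), tangentExp p y s := by
          -- On this interval of length one, (s - σ)² ≤ 1, whence the factor e^{-1}.
          refine setIntegral_mono_on continuous_const.integrableOn_Icc hi.integrableOn measurableSet_Icc fun s hs => ?_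
          have hs0 : 0 ≤ s := hσ0.trans hs.1
          rw [← Real.exp_add, tangentExp, tangentSlope_of_nonneg hp hs0]
          refine Real.exp_le_exp.2 ?_
          have := (tangent_bounds hp hp2 hs0 hy).1
          nlinarith [hs.1, hs.2]
      _ ≤ ∫ s, tangentExp p y s :=
          setIntegral_le_integral hi (Filter.Eventually.of_forall fun s => (Real.exp_pos _).le)
  · calc ∫ s, tangentExp p y s
        ≤ ∫ s, Real.exp (y ^ p) * (Real.exp (-(p - 1) * (s - y ^ (p / 2)) ^ 2) +
          Real.exp (-(p - 1) * (s - -y ^ (p / 2)) ^ 2)) :=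
          integral_mono hi ((i1.add i2).const_mul _) (tangentExp_le_of_nonneg hp hp2 hy)
      _ = 2 * √(Real.pi / (p - 1)) * Real.exp (y ^ p) := by
          rw [integral_const_mul, integral_add i1 i2,
            integral_sub_right_eq_self (fun s : ℝ => Real.exp (-(p - 1) * s ^ 2)),
            integral_sub_right_eq_self (fun s : ℝ => Real.exp (-(p - 1) * s ^ 2)),
            integral_gaussian]
          ring

/-- `exp |y|^p` is comparable to a superposition of linear exponentials. -/
lemma tangentExp_integral {p : ℝ} (hp : 1 < p) (hp2 : p ≤ 2) (y : ℝ) :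
    Integrable (tangentExp p y) ∧ Real.exp (-1) * Real.exp (|y| ^ p) ≤ ∫ s, tangentExp p y s ∧
      ∫ s, tangentExp p y s ≤ 2 * √(Real.pi / (p - 1)) * Real.exp (|y| ^ p) := by
  rcases le_total 0 y with hy | hy
  · rw [abs_of_nonneg hy]
    exact tangentExp_integral_of_nonneg hp hp2 hy
  · rw [abs_of_nonpos hy]
    have h := tangentExp_integral_of_nonneg hp hp2 (y := -y) (by linarith)
    have e : tangentExp p (-y) = fun s => tangentExp p y (-s) := by
      ext s
      rw [← tangentExp_neg, neg_neg]
    rw [e, integral_neg_eq_self (tangentExp p y)] at h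
    exact ⟨by simpa using h.1.comp_neg, h.2⟩

variable {n : ℕ}

/-- The constant in the upper bound of the subordination formula. -/
noncomputable def subordinationConst (p : Fin n → ℝ) : ℝ := ∏ j, (2 * √(Real.pi / (p j - 1)))

lemma subordinationConst_pos {p : Fin n → ℝ} (hp : ∀ j, 1 < p j ∧ p j ≤ 2) :
    0 < subordinationConst p := by
  refine Finset.prod_pos fun j _ => ?_
  have : 0 < p j - 1 := by linarith [(hp j).1]
  have := Real.pi_pos
  positivity

lemma lintegral_tangentExp {p : Fin n → ℝ} (hp : ∀ j, 1 < p j ∧ p j ≤ 2) (y : Fin n → ℝ) :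
    ENNReal.ofReal (Real.exp (-n)) * ENNReal.ofReal (Real.exp (∑ j, |y j| ^ p j)) ≤
        ∫⁻ s : Fin n → ℝ, ENNReal.ofReal (∏ j, tangentExp (p j) (y j) (s j)) ∧
      ∫⁻ s : Fin n → ℝ, ENNReal.ofReal (∏ j, tangentExp (p j) (y j) (s j)) ≤
        ENNReal.ofReal (subordinationConst p) *
          ENNReal.ofReal (Real.exp (∑ j, |y j| ^ p j)) := by
  have h := fun j => tangentExp_integral (hp j).1 (hp j).2 (y j)
  have hi : Integrable (fun s : Fin n → ℝ => ∏ j, tangentExp (p j) (y j) (s j)) :=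
    Integrable.fintype_prod (f := fun j => tangentExp (p j) (y j)) fun j => (h j).1
  rw [← ofReal_integral_eq_lintegral_ofReal hi (Filter.Eventually.of_forall fun s =>
    Finset.prod_nonneg fun j _ => (Real.exp_pos _).le),
    integral_fintype_prod_volume_eq_prod (fun j => tangentExp (p j) (y j)),
    ← ENNReal.ofReal_mul (Real.exp_pos _).le, ← ENNReal.ofReal_mul (subordinationConst_pos hp).le]
  constructor
  · refine ENNReal.ofReal_le_ofReal ?_
    have e : Real.exp (-n) * Real.exp (∑ j, |y j| ^ p j) =
        ∏ j, (Real.exp (-1) * Real.exp (|y j| ^ p j)) := by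
      rw [Finset.prod_mul_distrib, Real.exp_sum, Finset.prod_const, ← Real.exp_nat_mul]
      simp
    rw [e]
    exact Finset.prod_le_prod (fun j _ => by positivity) fun j _ => (h j).2.1
  · refine ENNReal.ofReal_le_ofReal ?_
    rw [Real.exp_sum, subordinationConst, ← Finset.prod_mul_distrib]
    exact Finset.prod_le_prod
      (fun j _ => integral_nonneg fun s => (Real.exp_pos _).le) fun j _ => (h j).2.2

end Subordination

/-! ### From linear weights to the weights of the theorem. -/

section Assembly

variable {n : ℕ}

lemma eLpNorm_two_mul_eq (w : EuclideanSpace ℝ (Fin n) → ℂ) (W : EuclideanSpace ℝ (Fin n) → ℝ)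
    (hW : ∀ x, ‖w x‖ ^ 2 = W x) (f : EuclideanSpace ℝ (Fin n) → ℂ) :
    eLpNorm (fun x => w x * f x) 2 volume =
      (∫⁻ x, ENNReal.ofReal (W x) * ‖f x‖ₑ ^ 2) ^ (1 / 2 : ℝ) := by
  rw [eLpNorm_eq_lintegral_rpow_enorm_toReal two_ne_zero ENNReal.ofNat_ne_top]
  simp only [ENNReal.toReal_ofNat, ENNReal.rpow_ofNat]
  congr 2
  ext x
  rw [enorm_mul, mul_pow, ← hW, ← ofReal_norm (w x), ENNReal.ofReal_pow (norm_nonneg _)]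

/-- The frequency `(2γ)^{1/p}` scaled tangent slopes, halved. -/
noncomputable def slopeVec (γ p : Fin n → ℝ) (s : Fin n → ℝ) (j : Fin n) : ℝ :=
  tangentSlope (p j) (s j) * (2 * γ j) ^ (1 / p j) / 2

lemma expNorm_sq (l : Fin n → ℝ) (f : EuclideanSpace ℝ (Fin n) → ℂ) :
    expNorm l f ^ 2 = ∫⁻ x, ENNReal.ofReal (Real.exp (2 * ∑ i, l i * x i)) * ‖f x‖ₑ ^ 2 := by
  rw [expNorm, eLpNorm_two_mul_eq _ (fun x => Real.exp (2 * ∑ i, l i * x i)) (fun x => by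
    rw [norm_gauss_zero, ← Real.exp_nat_mul]; simp), ← ENNReal.rpow_natCast, ← ENNReal.rpow_mul]
  norm_num

/-- Both γ and the 2 from squaring are absorbed into the argument of the power, so the final
constant does not depend on γ. -/
lemma weightedNorm_sq {γ p : Fin n → ℝ} (hp : ∀ j, 1 < p j ∧ p j ≤ 2) (hγ : ∀ j, 0 ≤ γ j) (κ : ℝ)
    (f : EuclideanSpace ℝ (Fin n) → ℂ) :
    weightedNorm γ p κ f ^ 2 = ∫⁻ x, ENNReal.ofReal
      (Real.exp (∑ j, |(2 * γ j) ^ (1 / p j) * (κ * x j)| ^ p j)) * ‖f x‖ₑ ^ 2 := by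
  rw [weightedNorm, eLpNorm_two_mul_eq _
    (fun x => Real.exp (∑ j, |(2 * γ j) ^ (1 / p j) * (κ * x j)| ^ p j)) (fun x => ?_),
    ← ENNReal.rpow_natCast, ← ENNReal.rpow_mul]
  · norm_num
  · rw [expWeight, Complex.norm_real, Real.norm_eq_abs, Real.abs_exp, ← Real.exp_nat_mul,
      Finset.mul_sum]
    congr 1
    refine Finset.sum_congr rfl fun j _ => ?_
    have hpj : p j ≠ 0 := by linarith [(hp j).1]
    have hg : 0 ≤ 2 * γ j := by linarith [hγ j]
    rw [abs_mul, Real.mul_rpow (abs_nonneg _) (abs_nonneg _),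
      abs_of_nonneg (Real.rpow_nonneg hg _), ← Real.rpow_mul hg, one_div_mul_cancel hpj,
      Real.rpow_one]
    simp
    ring

lemma measurable_slopeVec (γ p : Fin n → ℝ) (j : Fin n) :
    Measurable (fun s : Fin n → ℝ => slopeVec γ p s j) := by
  have := (measurable_tangentSlope (p j)).comp (measurable_pi_apply (X := fun _ : Fin n => ℝ) j)
  unfold slopeVec
  exact (this.mul_const _).div_const _

lemma measurable_expNorm_sq (γ p : Fin n → ℝ) (κ : ℝ) {f : EuclideanSpace ℝ (Fin n) → ℂ}
    (hf : Measurable f) :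
    Measurable (fun s : Fin n → ℝ => ENNReal.ofReal (Real.exp (-∑ j, (p j - 1) * s j ^ 2)) *
      expNorm (fun j => κ * slopeVec γ p s j) f ^ 2) := by
  simp only [expNorm_sq]
  refine Measurable.mul (by fun_prop) ?_
  refine Measurable.lintegral_prod_right' (f := fun q : (Fin n → ℝ) × EuclideanSpace ℝ (Fin n) =>
    ENNReal.ofReal (Real.exp (2 * ∑ i, κ * slopeVec γ p q.1 i * q.2 i)) * ‖f q.2‖ₑ ^ 2) ?_
  have : ∀ j, Measurable (fun q : (Fin n → ℝ) × EuclideanSpace ℝ (Fin n) =>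
      slopeVec γ p q.1 j) := fun j => (measurable_slopeVec γ p j).comp measurable_fst
  fun_prop

/-- The superposition of the norms with linear exponential weights. -/
noncomputable def expNormSuperposition (γ p : Fin n → ℝ) (κ : ℝ)
    (f : EuclideanSpace ℝ (Fin n) → ℂ) : ℝ≥0∞ :=
  ∫⁻ s : Fin n → ℝ, ENNReal.ofReal (Real.exp (-∑ j, (p j - 1) * s j ^ 2)) *
    expNorm (fun j => κ * slopeVec γ p s j) f ^ 2

lemma expNormSuperposition_eq (γ p : Fin n → ℝ) (κ : ℝ) {f : EuclideanSpace ℝ (Fin n) → ℂ}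
    (hf : Measurable f) :
    expNormSuperposition γ p κ f = ∫⁻ x, (∫⁻ s : Fin n → ℝ, ENNReal.ofReal
      (∏ j, tangentExp (p j) ((2 * γ j) ^ (1 / p j) * (κ * x j)) (s j))) * ‖f x‖ₑ ^ 2 := by
  have h1 : ∀ (s : Fin n → ℝ) (x : EuclideanSpace ℝ (Fin n)),
      ENNReal.ofReal (Real.exp (-∑ j, (p j - 1) * s j ^ 2)) *
        (ENNReal.ofReal (Real.exp (2 * ∑ j, κ * slopeVec γ p s j * x j)) * ‖f x‖ₑ ^ 2) =
      ENNReal.ofReal (∏ j, tangentExp (p j) ((2 * γ j) ^ (1 / p j) * (κ * x j)) (s j)) *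
        ‖f x‖ₑ ^ 2 := by
    intro s x
    rw [← mul_assoc, ← ENNReal.ofReal_mul (Real.exp_pos _).le, ← Real.exp_add]
    simp only [tangentExp]
    rw [← Real.exp_sum, Finset.sum_sub_distrib, Finset.mul_sum]
    congr 3
    rw [add_comm, ← sub_eq_add_neg]
    congr 1
    refine Finset.sum_congr rfl fun j _ => ?_
    rw [slopeVec]; ring
  have hmeas : Measurable (fun q : (Fin n → ℝ) × EuclideanSpace ℝ (Fin n) => ENNReal.ofReal
      (∏ j, tangentExp (p j) ((2 * γ j) ^ (1 / p j) * (κ * q.2 j)) (q.1 j)) * ‖f q.2‖ₑ ^ 2) := by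
    have : ∀ j, Measurable (fun q : (Fin n → ℝ) × EuclideanSpace ℝ (Fin n) =>
        tangentSlope (p j) (q.1 j)) := fun j =>
      (measurable_tangentSlope (p j)).comp ((measurable_pi_apply j).comp measurable_fst)
    unfold tangentExp
    fun_prop
  have h2 : expNormSuperposition γ p κ f = ∫⁻ s : Fin n → ℝ, ∫⁻ x, ENNReal.ofReal
      (∏ j, tangentExp (p j) ((2 * γ j) ^ (1 / p j) * (κ * x j)) (s j)) * ‖f x‖ₑ ^ 2 := by
    rw [expNormSuperposition]
    refine lintegral_congr fun s => ?_
    rw [expNorm_sq, ← lintegral_const_mul' _ _ ENNReal.ofReal_ne_top]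
    exact lintegral_congr fun x => h1 s x
  rw [h2, lintegral_lintegral_swap hmeas.aemeasurable]
  refine lintegral_congr fun x => ?_
  exact lintegral_mul_const' _ _ (by simp)

lemma weightedNorm_sq_le {γ p : Fin n → ℝ} (hp : ∀ j, 1 < p j ∧ p j ≤ 2) (hγ : ∀ j, 0 ≤ γ j)
    (κ : ℝ) {f : EuclideanSpace ℝ (Fin n) → ℂ} (hf : Measurable f) :
    ENNReal.ofReal (Real.exp (-n)) * weightedNorm γ p κ f ^ 2 ≤ expNormSuperposition γ p κ f := by
  rw [expNormSuperposition_eq γ p κ hf, weightedNorm_sq hp hγ,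
    ← lintegral_const_mul' _ _ ENNReal.ofReal_ne_top]
  refine lintegral_mono fun x => ?_
  rw [← mul_assoc]
  gcongr
  exact (lintegral_tangentExp hp fun j => (2 * γ j) ^ (1 / p j) * (κ * x j)).1

lemma expNormSuperposition_le {γ p : Fin n → ℝ} (hp : ∀ j, 1 < p j ∧ p j ≤ 2) (hγ : ∀ j, 0 ≤ γ j)
    (κ : ℝ) {f : EuclideanSpace ℝ (Fin n) → ℂ} (hf : Measurable f) :
    expNormSuperposition γ p κ f ≤
      ENNReal.ofReal (subordinationConst p) * weightedNorm γ p κ f ^ 2 := by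
  rw [expNormSuperposition_eq γ p κ hf, weightedNorm_sq hp hγ,
    ← lintegral_const_mul' _ _ ENNReal.ofReal_ne_top]
  refine lintegral_mono fun x => ?_
  rw [← mul_assoc]
  gcongr
  exact (lintegral_tangentExp hp fun j => (2 * γ j) ^ (1 / p j) * (κ * x j)).2

/-- Interpolation inequalities for linear exponential weights yield those for the weights
`exp (∑ γⱼ |xⱼ|^{pⱼ})`. -/
lemma weightedNorm_le_of_expNorm_le {γ p : Fin n → ℝ} (hp : ∀ j, 1 < p j ∧ p j ≤ 2)
    (hγ : ∀ j, 0 ≤ γ j) {κ κ₀ κ₁ θ : ℝ} {f f₀ f₁ : EuclideanSpace ℝ (Fin n) → ℂ}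
    (hf : Measurable f) (hf₀ : Measurable f₀) (hf₁ : Measurable f₁) (hθ : 0 ≤ θ) (hθ' : θ ≤ 1)
    (h : ∀ l : Fin n → ℝ, expNorm (fun j => κ * l j) f ≤
      expNorm (fun j => κ₀ * l j) f₀ ^ θ * expNorm (fun j => κ₁ * l j) f₁ ^ (1 - θ)) :
    weightedNorm γ p κ f ≤ ENNReal.ofReal √(Real.exp n * subordinationConst p) *
      (weightedNorm γ p κ₀ f₀ ^ θ * weightedNorm γ p κ₁ f₁ ^ (1 - θ)) := by
  have hθ1 : 0 ≤ 1 - θ := by linarith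
  have hsq : ∀ (N : ℝ≥0∞) (r : ℝ), (N ^ r) ^ 2 = (N ^ 2) ^ r := fun N r => by
    rw [← ENNReal.rpow_natCast, ← ENNReal.rpow_natCast, ← ENNReal.rpow_mul, ← ENNReal.rpow_mul,
      mul_comm]
  have hsplit : ∀ N : ℝ≥0∞, N ^ θ * N ^ (1 - θ) = N := fun N => by
    rw [← ENNReal.rpow_add_of_nonneg _ _ hθ hθ1, add_sub_cancel, ENNReal.rpow_one]
  have h1 : expNormSuperposition γ p κ f ≤
      expNormSuperposition γ p κ₀ f₀ ^ θ * expNormSuperposition γ p κ₁ f₁ ^ (1 - θ) := by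
    -- Hölder in the tangent parameter: the Gaussian density is common to all three superpositions
    -- and splits into its powers θ and 1 - θ.
    refine le_trans (lintegral_mono fun s => ?_) (ENNReal.lintegral_mul_norm_pow_le
      (measurable_expNorm_sq γ p κ₀ hf₀).aemeasurable (measurable_expNorm_sq γ p κ₁ hf₁).aemeasurable
      hθ hθ1 (by ring))
    rw [ENNReal.mul_rpow_of_nonneg _ _ hθ, ENNReal.mul_rpow_of_nonneg _ _ hθ1, mul_mul_mul_comm,
      hsplit, ← hsq, ← hsq, ← mul_pow]
    gcongr
    exact h _
  have h2 := (weightedNorm_sq_le hp hγ κ hf).trans (h1.trans (mul_le_mul'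
    (ENNReal.rpow_le_rpow (expNormSuperposition_le hp hγ κ₀ hf₀) hθ)
    (ENNReal.rpow_le_rpow (expNormSuperposition_le hp hγ κ₁ hf₁) hθ1)))
  rw [ENNReal.mul_rpow_of_nonneg _ _ hθ, ENNReal.mul_rpow_of_nonneg _ _ hθ1, mul_mul_mul_comm,
    hsplit, ← hsq, ← hsq, ← mul_pow] at h2
  have h3 : weightedNorm γ p κ f ^ 2 ≤ (ENNReal.ofReal √(Real.exp n * subordinationConst p) *
      (weightedNorm γ p κ₀ f₀ ^ θ * weightedNorm γ p κ₁ f₁ ^ (1 - θ))) ^ 2 := by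
    have hs := (subordinationConst_pos hp).le
    rw [mul_pow, ← ENNReal.ofReal_pow (Real.sqrt_nonneg _), Real.sq_sqrt (by positivity),
      ENNReal.ofReal_mul (Real.exp_pos _).le, mul_assoc]
    calc weightedNorm γ p κ f ^ 2 = ENNReal.ofReal (Real.exp n) *
          (ENNReal.ofReal (Real.exp (-n)) * weightedNorm γ p κ f ^ 2) := by
            rw [← mul_assoc, ← ENNReal.ofReal_mul (Real.exp_pos _).le, ← Real.exp_add]
            simp
      _ ≤ _ := by gcongr
  exact (ENNReal.pow_le_pow_left_iff two_ne_zero).1 h3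

lemma measurable_fourierHat (f : L2Space n) : Measurable (fourierHat f) := by
  have := (Lp.stronglyMeasurable (𝓕 f : L2Space n)).measurable
  unfold fourierHat
  exact (this.comp (measurable_const_smul _)).const_mul _

/-- Under ξ = 2πη the prefactor (2π)^{-n/2} cancels the square root of the Jacobian. -/
lemma expNorm_fourierHat (m : Fin n → ℝ) (f : L2Space n) :
    expNorm (fun i => 2 * m i) (fourierHat f) =
      expNorm (fun i => 4 * Real.pi * m i) (𝓕 f : L2Space n) := by
  have hpi : (0 : ℝ) < 2 * Real.pi := by positivity
  set h : EuclideanSpace ℝ (Fin n) → ℂ := fun η =>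
    gauss 0 (fun i => ((4 * Real.pi * m i : ℝ) : ℂ)) η * (𝓕 f : L2Space n) η with hh
  have hm : StronglyMeasurable h :=
    (continuous_gauss _ _).stronglyMeasurable.mul (Lp.stronglyMeasurable _)
  have e : (fun x => gauss 0 (fun i => ((2 * m i : ℝ) : ℂ)) x * fourierHat f x) =
      (((2 * Real.pi) ^ (-(n : ℝ) / 2) : ℝ) : ℂ) • (h ∘ fun x => (2 * Real.pi)⁻¹ • x) := by
    ext x
    simp only [Pi.smul_apply, smul_eq_mul, Function.comp_apply, hh, fourierHat]
    have : gauss 0 (fun i => ((2 * m i : ℝ) : ℂ)) x =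
        gauss 0 (fun i => ((4 * Real.pi * m i : ℝ) : ℂ)) ((2 * Real.pi)⁻¹ • x) := by
      simp only [gauss]
      congr 2
      · simp
      · refine Finset.sum_congr rfl fun i _ => ?_
        have : (Real.pi : ℂ) ≠ 0 := Complex.ofReal_ne_zero.2 Real.pi_ne_zero
        simp
        field_simp
        ring
    rw [this]
    ring
  rw [expNorm, e, eLpNorm_const_smul, ← eLpNorm_map_measure (by exact hm.aestronglyMeasurable)
    (measurable_const_smul _).aemeasurable, Measure.map_addHaar_smul _ (inv_ne_zero hpi.ne'),
    eLpNorm_smul_measure_of_ne_top ENNReal.ofNat_ne_top, expNorm, smul_eq_mul, ← mul_assoc]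
  have : ‖(((2 * Real.pi) ^ (-(n : ℝ) / 2) : ℝ) : ℂ)‖ₑ *
      ENNReal.ofReal |(((2 * Real.pi)⁻¹ ^ Module.finrank ℝ (EuclideanSpace ℝ (Fin n)))⁻¹)| ^
        (1 / 2 : ℝ≥0∞).toReal = 1 := by
    have h2 : (1 / 2 : ℝ≥0∞).toReal = 1 / 2 := by simp
    rw [h2, ← ofReal_norm, Complex.norm_real, Real.norm_of_nonneg (by positivity), finrank_euclideanSpace_fin,
      abs_of_nonneg (by positivity), ENNReal.ofReal_rpow_of_nonneg (by positivity) (by norm_num),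
      ← ENNReal.ofReal_mul (by positivity), ENNReal.ofReal_eq_one, inv_pow, inv_inv,
      ← Real.rpow_natCast, ← Real.rpow_mul hpi.le, ← Real.rpow_add hpi]
    have : -(n : ℝ) / 2 + n * (1 / 2) = 0 := by ring
    rw [this, Real.rpow_zero]
  rw [this, one_mul]

lemma IsFreeEvolution.expNorm_fourier_eq {s : ℝ} {f g : L2Space n} (h : IsFreeEvolution s f g)
    (l : Fin n → ℝ) : expNorm l (𝓕 g : L2Space n) = expNorm l (𝓕 f : L2Space n) := by
  refine eLpNorm_congr_norm_ae ?_
  filter_upwards [h] with ξ hξ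
  rw [hξ, norm_mul, norm_mul, norm_mul, norm_gauss_I, one_mul]

end Assembly

/-! ### The two interpolation inequalities. -/

theorem corollary3p2 (n : ℕ) (p : Fin n → ℝ) (hp : ∀ j, 1 < p j ∧ p j ≤ 2) :
    ∃ c : ℝ, 0 < c ∧
      ∀ (γ : Fin n → ℝ), (∀ j, 0 ≤ γ j) →
      ∀ (α β : ℝ), 0 < α → 0 < β →
      ∀ u : ℝ → L2Space n, IsFreeSchrodingerSolution u →
        (∀ T t : ℝ, 0 < T → 0 ≤ t → t ≤ T →
          weightedNorm γ p (1 / (α * t + β)) (u t) ≤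
            ENNReal.ofReal c *
              (weightedNorm γ p (1 / β) (u 0) ^ thetaExp α β T t *
                weightedNorm γ p (1 / (α * T + β)) (u T) ^ (1 - thetaExp α β T t))) ∧
        (∀ t : ℝ, 0 ≤ t →
          weightedNorm γ p (1 / (α * t + β)) (u t) ≤
            ENNReal.ofReal c *
              (weightedNorm γ p (1 / β) (u 0) ^ muExp α β t *
                weightedNorm γ p (2 / α) (fourierHat (u 0)) ^ (1 - muExp α β t))) := by
  refine ⟨√(Real.exp n * subordinationConst p), Real.sqrt_pos.2
    (mul_pos (Real.exp_pos _) (subordinationConst_pos hp)), ?_⟩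
  intro γ hγ α β hα hβ u hu
  -- Starting the clock at -β/α makes αt + β proportional to elapsed time.
  obtain ⟨v, hv⟩ := exists_isFreeEvolution (-(β / α)) (u 0)
  have hv0 := hv.symm
  rw [neg_neg] at hv0
  have hev : ∀ t, 0 ≤ t → IsFreeEvolution (β / α + t) v (u t) := fun t ht =>
    hv0.trans (hu.isFreeEvolution ht)
  have hmeas : ∀ f : L2Space n, Measurable f := fun f => (Lp.stronglyMeasurable f).measurable
  have hs : ∀ t, 0 ≤ t → 0 < β / α + t := fun t ht => by positivity
  have hd : ∀ t, 0 ≤ t → 0 < α * t + β := fun t ht => by positivity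
  have hκ : ∀ t, 0 ≤ t → ∀ l : Fin n → ℝ, (fun j => 1 / (α * t + β) * l j) =
      fun j => (β / α + t)⁻¹ * (l j / α) := fun t ht l => by
    have := hs t ht
    have := hd t ht
    ext j
    field_simp
    ring
  have hN : ∀ t, 0 ≤ t → ∀ l : Fin n → ℝ, IsPhaseShiftNorm v (fun j => l j / α) (β / α + t)⁻¹
      (expNorm (fun j => 1 / (α * t + β) * l j) (u t)) := fun t ht l => by
    rw [hκ t ht l]
    exact isPhaseShiftNorm_expNorm (hs t ht).ne' (hev t ht) _
  have e0 : α * 0 + β = β := by ring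
  have hN0 := hN 0 le_rfl
  rw [e0] at hN0
  have hk0 := hκ 0 le_rfl
  constructor
  · intro T t hT ht htT
    have hdt := hd t ht
    have hdT := hd T hT.le
    have hst := hs t ht
    have hsT := hs T hT.le
    have hθ0 : 0 ≤ thetaExp α β T t :=
      div_nonneg (mul_nonneg hβ.le (by linarith)) (by positivity)
    have hθ1 : 1 - thetaExp α β T t = (α * T + β) * t / (T * (α * t + β)) := by
      rw [thetaExp]; field_simp; ring
    have hθ1' : 0 ≤ 1 - thetaExp α β T t := by rw [hθ1]; positivity
    refine weightedNorm_le_of_expNorm_le hp hγ (hmeas _) (hmeas _) (hmeas _) hθ0 (by linarith)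
      fun l => ?_
    -- At the endpoints one factor is a⁰ = 1, even for a = ∞, and the inequality is trivial;
    -- convexity is needed only for exponents strictly between 0 and 1.
    rcases ht.eq_or_lt with rfl | ht0
    · have : thetaExp α β T 0 = 1 := by
        have : 1 - thetaExp α β T 0 = 0 := by rw [hθ1]; simp
        linarith
      simp [this]
    rcases htT.eq_or_lt with rfl | htT
    · have : thetaExp α β t t = 0 := by simp [thetaExp]
      simp [this]
    have hθ1p : 0 < 1 - thetaExp α β T t := by rw [hθ1]; positivity
    have hθ0p : 0 < thetaExp α β T t := div_pos (mul_pos hβ (by linarith)) (by positivity)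
    have key := expNorm_le_of_isPhaseShiftNorm hst.ne' (hev t ht) (hN0 l) (hN T hT.le l)
      hθ0p (by linarith) (by rw [hθ1, thetaExp]; field_simp; ring)
    rwa [← hκ t ht l] at key
  · intro t ht
    have hdt := hd t ht
    have hst := hs t ht
    have hμ0 : 0 < muExp α β t := div_pos hβ hdt
    have hμ1 : 1 - muExp α β t = α * t / (α * t + β) := by
      rw [muExp]; field_simp; ring
    have hμ1' : 0 ≤ 1 - muExp α β t := by rw [hμ1]; positivity
    refine weightedNorm_le_of_expNorm_le hp hγ (hmeas _) (hmeas _) (measurable_fourierHat _) hμ0.le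
      (by linarith) fun l => ?_
    rcases ht.eq_or_lt with rfl | ht0
    · have : muExp α β 0 = 1 := by simp [muExp, hβ.ne']
      simp [this]
    have hμ1p : 0 < 1 - muExp α β t := by rw [hμ1]; positivity
    have key := expNorm_le_of_isPhaseShiftNorm hst.ne' (hev t ht) (hN0 l)
      (isPhaseShiftNorm_fourier v fun j => l j / α) hμ0 (by linarith)
      (by rw [muExp]; field_simp; ring)
    -- The flow multiplier is unimodular, so the Fourier weight sees `u 0` and `v` alike.
    rw [← hκ t ht l, ← hv0.expNorm_fourier_eq, ← expNorm_fourierHat] at key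
    have e : (fun j => 2 / α * l j) = fun j => 2 * (l j / α) := by ext j; ring
    rwa [e]
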